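/- Let $G=(V_G,E_G)$ be a digraph without loops (possibly infinite), $R$ a commutative ring with unit, $K$ a field of characteristic $0$. **Path chains.** Let $\Lambda_n(R)$ ($n\ge 0$) be the free $R$-module on all sequences $e_{v_0,\dots,v_n}$ in $V_G$, $\Lambda_n(R)=0$ for $n<0$, with $\partial e_{v_0,\dots,v_n}=\sum_i(-1)^ie_{v_0,\dots,\hat v_i,\dots,v_n}$ for $n\ge1$ and $\partial=0$ for $n=0$. Let $\mathcal A_n(G;R)$ be the span of the $n$-paths of $G$ (all $(v_{i-1},v_i)\in E_G$), and $\Omega_n(G;R)$ the set of $x\in\mathcal A_n(G;R)$ such that $\partial x$ is in $\mathcal A_{n-1}(G;R)$ modulo sequences with two equal consecutive entries. The head set $\bar h(x)$ of $x$ is the set of last vertices of the paths with nonzero coefficient in $x$; $x$ is upper connected with head $h(x)$ if $\bar h(x)=\{h(x)\}$. Let $\delta^h_u$ be the linear map that sends $e_{v_0,\dots,v_n}$ to $e_{v_0,\dots,v_{n-1}}$ if $n\ge1$ and $v_{n-1}=u$, and to $0$ otherwise. The upper extension $[x]^v$ is the linear extension of $e_{v_0,\dots,v_n}\mapsto e_{v_0,\dots,v_n,v}$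 if this is a path of $G$, and $\mapsto 0$ otherwise. **Face multihypergraphs.** An upper face multihypergraph $F$ on $x_1,\dots,x_m\in\Omega_n(G;R)$, where $x_i\ne-x_j$ for $i\ne j$, consists of vertices $1,\dots,m$ (labelled $x_1,\dots,x_m$); for each $i$ and $u\in V_G$, a decomposition $\delta^h_u(x_i)=x_i^{u,1}+\dots+x_i^{u,m_i^u}$ with terms in $\Omega_{n-1}(G;R)$, no nonempty subsequence of which sums to $0$; and hyperedges, each labelled by some $u\in V_G$ and a set of terms $x_i^{u,k}$ (regarded as indexed by $(i,k)$) and joining the vertices $i$ that occur. A label is either a pair $x_i^{u,k}=-x_j^{u,l}$ with $i\ne j$, or a set of $t\ge3$ terms, not all with the same $i$, that are all equal and sum to $0$. Each $x_i^{u,k}$ lies in at most one label. A mutation of $F$ is a face multihypergraph with the same vertices and decompositions that is obtained by regrouping the members of two labels of equal size $t\ge 2$ and with the same $u$ into two labels of size $t$, or by replacing two labels of equal size $t\ge3$ and with the same $u$ by $t$ pairs that match the members of one with those of the other, or by the reverse of this. $F$ is strongly connected if every face multihypergraph obtained from it by finitely many (possibly zero) mutations is connected. For $v\in V_G$, $[x_1+\dots+x_m]^v$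 is an upper extension over $F$ if $(w,v)\in E_G$ for all $i$ and $w\in\bar h(x_i)$. It is $v$-complete if every hyperedge label has $u\neq v$ and $(u,v)\notin E_G$, and if, conversely, for all $i$ and all $u\ne v$ with $\delta^h_u(x_i)\ne0$ and $(u,v)\notin E_G$, every $x_i^{u,k}$, $1\le k\le m_i^u$, lies in a label. **Inductive elements.** Let $\bar E^h_{-1}=\emptyset$ and $\bar E^h_0=\{\pm e_v\mid v\in V_G\}$. For $n\ge1$ let $\bar E^h_n=\bar E^h_n(G;R)$ be the set of upper connected $x\in\Omega_n(G;R)$ that are upper extensions $[x_1+\dots+x_m]^{h(x)}$ over some strongly connected, $h(x)$-complete upper face multihypergraph on $x_1,\dots,x_m\in\Omega_{n-1}(G;R)$ such that each $x_i$ is up to sign in $\bar E^h_{n-1}$ and each $x_i^{u,k}$ is up to sign in $\bar E^h_{n-2}$. These are the $n$-dimensional upper inductive elements. The set $\bar E^t_n(G;R)$ of lower inductive elements is defined in the same way with heads replaced by tails (first vertices), extension at the end of a path by extension at its beginning, and all edges $(u,v)$, $(w,v)$ in the conditions by $(v,u)$, $(v,w)$. **Statement.** For $\bar E_n=\bar E_n^h$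 and likewise for $\bar E_n=\bar E_n^t$: 1. For $i=0,1,2$, $\bar E_i(G;\mathbb Z)$ contains a $\mathbb Z$-basis of $\Omega_i(G;\mathbb Z)$ and $\bar E_i(G;K)$ contains a $K$-basis of $\Omega_i(G;K)$. 2. $\bar E_3(G;\mathbb Z)$ generates $\Omega_3(G;\mathbb Z)$. 3. A subset of $\bar E_3(G;K)$ is a $K$-basis of $\Omega_3(G;K)$. Moreover, the bases over $K$ in 1 and 3 can be chosen to consist of images of elements of $\bar E_i(G;\mathbb Z)$, respectively $\bar E_3(G;\mathbb Z)$, under $\Omega_n(G;\mathbb Z)\to\Omega_n(G;K)$. -/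

import Mathlib

namespace PathHom

section Chains

open scoped Classical

/-- The free `R`-module on all finite sequences in `V`. The elementary `n`-path
`e_{v_0,…,v_n}` is the basis vector of the list `[v_0, …, v_n]` of length `n + 1`. -/
abbrev Chains (V R : Type*) [CommRing R] : Type _ := List V →₀ R

/-- The elementary path `e_l`. -/
noncomputable def path {V : Type*} (R : Type*) [CommRing R] (l : List V) : Chains V R :=
  Finsupp.single l 1

/-- The path differential `∂ e_{v_0,…,v_n} = ∑ i, (-1)^i e_{v_0,…,v̂_i,…,v_n}` for `n ≥ 1`;
it vanishes on `0`-paths. -/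
noncomputable def boundary (V R : Type*) [CommRing R] : Chains V R →ₗ[R] Chains V R :=
  Finsupp.linearCombination R fun l : List V =>
    if 2 ≤ l.length then
      ∑ i ∈ Finset.range l.length, (-1 : R) ^ i • path R (l.eraseIdx i)
    else 0

/-- `𝒜_n(G;R)`: the span of the allowed `n`-paths of `G` (zero for `n < 0`). -/
noncomputable def allowed {V : Type*} (G : Digraph V) (R : Type*) [CommRing R] (n : ℤ) :
    Submodule R (Chains V R) :=
  Finsupp.supported R R {l | l ≠ [] ∧ (l.length : ℤ) = n + 1 ∧ l.IsChain G.Adj}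

/-- `ℐ_n(V;R)`: the span of the irregular `n`-paths, those with two equal consecutive
vertices. -/
noncomputable def irregular (V R : Type*) [CommRing R] (n : ℤ) : Submodule R (Chains V R) :=
  Finsupp.supported R R {l | (l.length : ℤ) = n + 1 ∧ ¬ l.IsChain (· ≠ ·)}

/-- `Ω_n(G;R)`: the allowed `x` such that the class of `∂ x` modulo irregular paths is
allowed. Classes of allowed chains are identified with their unique allowed representative. -/
noncomputable def Omega {V : Type*} (G : Digraph V) (R : Type*) [CommRing R] (n : ℤ) :
    Submodule R (Chains V R) :=
  allowed G R n ⊓ (allowed G R (n - 1) ⊔ irregular V R (n - 1)).comap (boundary V R)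

/-- The change of coefficients `Ω_n(G;ℤ) → Ω_n(G;K)`, on all chains. -/
noncomputable def ofInt {V : Type*} (K : Type*) [CommRing K] (x : Chains V ℤ) : Chains V K :=
  Finsupp.mapRange (Int.cast : ℤ → K) Int.cast_zero x

/-- The upper constructions work at the heads of paths, the lower ones at the tails. -/
inductive Side
  | upper
  | lower

/-- The end of a path at the given side: the last vertex for `upper`, the first for `lower`. -/
def Side.endpoint {V : Type*} : Side → List V → Option V
  | .upper, l => l.getLast?
  | .lower, l => l.head?

/-- A path with the vertex at the given side removed. -/
def Side.truncate {V : Type*} : Side → List V → List V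
  | .upper, l => l.dropLast
  | .lower, l => l.tail

/-- A path with the vertex `v` added at the given side. -/
def Side.add {V : Type*} : Side → V → List V → List V
  | .upper, v, l => l ++ [v]
  | .lower, v, l => v :: l

/-- `(u,v) ∈ E_G` in the upper case, `(v,u) ∈ E_G` in the lower case. -/
def Side.Joins {V : Type*} (G : Digraph V) : Side → V → V → Prop
  | .upper, u, v => G.Adj u v
  | .lower, u, v => G.Adj v u

/-- The head set (`upper`) or tail set (`lower`) of a chain. -/
def endSet {V R : Type*} [CommRing R] (s : Side) (x : Chains V R) : Set V :=
  {v | ∃ l ∈ x.support, s.endpoint l = some v}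

/-- `δ^h_{n,u}` (`upper`): `e_{v_0,…,v_n}` goes to `e_{v_0,…,v_{n-1}}` if `v_{n-1} = u` and to
`0` otherwise. `δ^t_{n,u}` (`lower`): `e_{v_0,…,v_n}` goes to `e_{v_1,…,v_n}` if `v_1 = u` and
to `0` otherwise. Both vanish on `0`-paths. -/
noncomputable def face {V : Type*} (R : Type*) [CommRing R] (s : Side) (u : V) :
    Chains V R →ₗ[R] Chains V R :=
  Finsupp.linearCombination R fun l : List V =>
    if s.endpoint (s.truncate l) = some u then path R (s.truncate l) else 0

/-- The upper extension `[x]^v` or the lower extension `[x]_v`: each path is extended by `v`,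
and those that are then not paths of `G` are dropped. -/
noncomputable def extend {V : Type*} (G : Digraph V) (R : Type*) [CommRing R] (s : Side) (v : V) :
    Chains V R →ₗ[R] Chains V R :=
  Finsupp.linearCombination R fun l : List V =>
    if (s.add v l).IsChain G.Adj then path R (s.add v l) else 0

end Chains

/-- The vertices and the face decompositions of a face multihypergraph on a sequence
`x_1,…,x_m` of elements of `Ω_n(G;R)` with `x_i ≠ -x_j` for `i ≠ j`: for each `u` and `i`, a
sequence `x_i^{u,1},…,x_i^{u,m_i^u}` in `Ω_{n-1}(G;R)` with sum `δ_{n,u}(x_i)`, no nonempty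
subsequence of which sums to zero (so it is empty when `δ_{n,u}(x_i) = 0`).
Here `mult u i = m_i^u`, and `part u i k` for `k < mult u i` are the `x_i^{u,k}`. -/
structure FaceDecomposition {V : Type*} (G : Digraph V) (R : Type*) [CommRing R] (s : Side)
    (n : ℤ) {m : ℕ} (x : Fin m → Chains V R) where
  vertex_mem : ∀ i, x i ∈ Omega G R n
  vertex_ne_neg : ∀ i j, i ≠ j → x i ≠ -x j
  mult : V → Fin m → ℕ
  part : V → Fin m → ℕ → Chains V R
  part_mem : ∀ u i k, k < mult u i → part u i k ∈ Omega G R (n - 1)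
  sum_part : ∀ u i, ∑ k ∈ Finset.range (mult u i), part u i k = face R s u (x i)
  sum_ne_zero : ∀ u i (T : Finset ℕ), T ⊆ Finset.range (mult u i) → T.Nonempty →
    ∑ k ∈ T, part u i k ≠ 0

/-- A label of a hyperedge: the vertex `u` and the set of the `x_i^{u,k}` in the label, each
recorded by its indices `(i,k)`. The hyperedge joins the vertices `i` that occur in it. -/
abbrev Label (V : Type*) (m : ℕ) : Type _ := V × Finset (Fin m × ℕ)

section FaceMultihypergraph

variable {V : Type*} {G : Digraph V} {R : Type*} [CommRing R] {s : Side} {n : ℤ} {m : ℕ}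
  {x : Fin m → Chains V R}

/-- `E` is the set of (labels of) hyperedges of a face multihypergraph with the vertices and
face decompositions `D`. As no `x_i^{u,k}` occurs in two labels, hyperedges are determined by
their labels. -/
structure IsFaceMultihypergraph (D : FaceDecomposition G R s n x) (E : Set (Label V m)) :
    Prop where
  index_lt : ∀ e ∈ E, ∀ p ∈ e.2, p.2 < D.mult e.1 p.1
  edge_or_hyperedge : ∀ e ∈ E,
    (∃ p q : Fin m × ℕ, p.1 ≠ q.1 ∧ e.2 = {p, q} ∧
      D.part e.1 p.1 p.2 = -D.part e.1 q.1 q.2) ∨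
    (3 ≤ e.2.card ∧ (∃ p ∈ e.2, ∃ q ∈ e.2, p.1 ≠ q.1) ∧
      (∀ p ∈ e.2, ∀ q ∈ e.2, D.part e.1 p.1 p.2 = D.part e.1 q.1 q.2) ∧
      ∑ p ∈ e.2, D.part e.1 p.1 p.2 = 0)
  label_disjoint : ∀ e ∈ E, ∀ e' ∈ E, e ≠ e' → e.1 = e'.1 → Disjoint e.2 e'.2

/-- Connectedness of the underlying multihypergraph. -/
def IsConnected (E : Set (Label V m)) : Prop :=
  ∀ i j : Fin m,
    Relation.ReflTransGen (fun i j => ∃ e ∈ E, ∃ p ∈ e.2, ∃ q ∈ e.2, p.1 = i ∧ q.1 = j) i j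

/-- The operations that generate mutations. The first regroups the members of two labels of the
same size `t`, with the same `u`, into two labels of size `t` (for `t = 2` this is the mutation
on edges). The second replaces two labels of the same size `t ≥ 3`, with the same `u`, by `t`
edges that match the members of the one with those of the other. -/
def MutationStep (E E' : Set (Label V m)) : Prop :=
  (∃ (u : V) (a b a' b' : Finset (Fin m × ℕ)),
    (u, a) ∈ E ∧ (u, b) ∈ E ∧ a ≠ b ∧ a.card = b.card ∧
    a'.card = a.card ∧ b'.card = a.card ∧ a' ∪ b' = a ∪ b ∧
    E' = (E \ {(u, a), (u, b)}) ∪ {(u, a'), (u, b')}) ∨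
  (∃ (u : V) (a b : Finset (Fin m × ℕ)) (σ : a ≃ b),
    (u, a) ∈ E ∧ (u, b) ∈ E ∧ a ≠ b ∧ 3 ≤ a.card ∧
    E' = (E \ {(u, a), (u, b)}) ∪
      Set.range fun p : a => (u, {(p : Fin m × ℕ), ((σ p : b) : Fin m × ℕ)}))

/-- Mutation equivalence: the equivalence relation generated by the mutations between face
multihypergraphs with the same vertices and face decompositions. -/
def MutationEquivalent (D : FaceDecomposition G R s n x) :
    Set (Label V m) → Set (Label V m) → Prop :=
  Relation.EqvGen fun E E' =>
    IsFaceMultihypergraph D E ∧ IsFaceMultihypergraph D E' ∧ MutationStep E E'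

/-- All mutation equivalent face multihypergraphs, itself included, are connected. -/
def IsStronglyConnected (D : FaceDecomposition G R s n x) (E : Set (Label V m)) : Prop :=
  ∀ E', MutationEquivalent D E E' → IsConnected E'

/-- The extension of `x_1 + ⋯ + x_m` by `v` is an extension over the face multihypergraph. -/
def ExtendsBy (G : Digraph V) (s : Side) (x : Fin m → Chains V R) (v : V) : Prop :=
  ∀ i, ∀ w ∈ endSet s (x i), s.Joins G w v

/-- `v`-properness. -/
def IsProper (G : Digraph V) (s : Side) (E : Set (Label V m)) (v : V) : Prop :=
  ∀ e ∈ E, ¬ s.Joins G e.1 v ∧ e.1 ≠ v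

/-- `v`-completeness. The `u` with `δ_{n,u}(x_i) ≠ 0` are the heads (tails) of the terms of
`δ_n(x_i) = ∑ u, δ_{n,u}(x_i)`. -/
def IsComplete (D : FaceDecomposition G R s n x) (E : Set (Label V m)) (v : V) : Prop :=
  IsProper G s E v ∧
  ∀ i u, face R s u (x i) ≠ 0 → u ≠ v → ¬ s.Joins G u v →
    ∀ k < D.mult u i, ∃ e ∈ E, e.1 = u ∧ (i, k) ∈ e.2

end FaceMultihypergraph

/-- `y ∈ Ω_n(G;R)` is upper (lower) `(E₁,E₂)`-inductive: it is upper (lower) connected, with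
head (tail) `v`, and it is the extension by `v` over a strongly connected `v`-complete face
multihypergraph whose vertices lie in `E₁` up to sign and whose face decompositions have
their terms in `E₂` up to sign. -/
def IsInductive {V : Type*} (G : Digraph V) (R : Type*) [CommRing R] (s : Side) (n : ℤ)
    (E₁ E₂ : Set (Chains V R)) (y : Chains V R) : Prop :=
  y ∈ Omega G R n ∧
  ∃ v : V, endSet s y = {v} ∧
  ∃ (m : ℕ) (x : Fin m → Chains V R) (D : FaceDecomposition G R s (n - 1) x)
    (E : Set (Label V m)),
    IsFaceMultihypergraph D E ∧ IsStronglyConnected D E ∧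
    ExtendsBy G s x v ∧ IsComplete D E v ∧
    y = extend G R s v (∑ i, x i) ∧
    (∀ i, x i ∈ E₁ ∨ -x i ∈ E₁) ∧
    (∀ u i k, k < D.mult u i → D.part u i k ∈ E₂ ∨ -D.part u i k ∈ E₂)

/-- The set of `n`-dimensional upper (lower) inductive elements. The set in dimension `-1`
is empty. -/
def inductiveElements {V : Type*} (G : Digraph V) (R : Type*) [CommRing R] (s : Side) :
    ℕ → Set (Chains V R)
  | 0 => {y | ∃ v : V, y = path R [v] ∨ y = -path R [v]}
  | 1 => {y | IsInductive G R s 1 (inductiveElements G R s 0) ∅ y}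
  | n + 2 => {y | IsInductive G R s ((n : ℤ) + 2)
      (inductiveElements G R s (n + 1)) (inductiveElements G R s n) y}

/-- `B` is an `R`-basis of the submodule `M`. -/
def IsBasisOf {R A : Type*} [CommRing R] [AddCommGroup A] [Module R A]
    (B : Set A) (M : Submodule R A) : Prop :=
  LinearIndependent R (fun b : B => (b : A)) ∧ Submodule.span R B = M

end PathHom

namespace PathHom

/-! ### Functoriality of inductive elements -/

/-- An additive map of chains that is compatible with all the structure that enters the
definition of inductive elements. -/
structure IsPathEmbedding {V R R' : Type*} [CommRing R] [CommRing R'] (G G' : Digraph V)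
    (s s' : Side) (F : Chains V R →+ Chains V R') : Prop where
  injective : Function.Injective F
  mem_omega : ∀ n x, x ∈ Omega G R n → F x ∈ Omega G' R' n
  face_map : ∀ u x, face R' s' u (F x) = F (face R s u x)
  extend_map : ∀ v x, extend G' R' s' v (F x) = F (extend G R s v x)
  endSet_map : ∀ x, endSet s' (F x) = endSet s x
  joins_iff : ∀ u v, s'.Joins G' u v ↔ s.Joins G u v
  path_map : ∀ v, F (path R [v]) = path R' [v]

namespace IsPathEmbedding

variable {V R R' : Type*} [CommRing R] [CommRing R'] {G G' : Digraph V}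
    {s s' : Side} {F : Chains V R →+ Chains V R'}

/-- The image of a face decomposition. -/
noncomputable def mapDecomposition (hF : IsPathEmbedding G G' s s' F) {n : ℤ} {m : ℕ} {x : Fin m → Chains V R}
    (D : FaceDecomposition G R s n x) : FaceDecomposition G' R' s' n (fun i => F (x i)) where
  vertex_mem i := hF.mem_omega _ _ (D.vertex_mem i)
  vertex_ne_neg i j h e := D.vertex_ne_neg i j h (hF.injective (by rw [e, map_neg]))
  mult := D.mult
  part u i k := F (D.part u i k)
  part_mem u i k h := hF.mem_omega _ _ (D.part_mem u i k h)
  sum_part u i := by rw [← map_sum, D.sum_part, hF.face_map]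
  sum_ne_zero u i T h h' e := D.sum_ne_zero u i T h h'
    (hF.injective (by rw [map_sum, e, map_zero]))

/-- Both directions are needed: strong connectedness of the image quantifies over its mutations,
which have to be pulled back to mutations of the original. Injectivity makes every relation between
terms hold before the map exactly when it holds after. -/
theorem isFaceMultihypergraph_iff (hF : IsPathEmbedding G G' s s' F) {n : ℤ} {m : ℕ}
    {x : Fin m → Chains V R} (D : FaceDecomposition G R s n x) (E : Set (Label V m)) :
    IsFaceMultihypergraph (hF.mapDecomposition D) E ↔ IsFaceMultihypergraph D E := by
  have key : ∀ e : Label V m,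
      ((∃ p q : Fin m × ℕ, p.1 ≠ q.1 ∧ e.2 = {p, q} ∧
        (hF.mapDecomposition D).part e.1 p.1 p.2 = -(hF.mapDecomposition D).part e.1 q.1 q.2) ∨
      (3 ≤ e.2.card ∧ (∃ p ∈ e.2, ∃ q ∈ e.2, p.1 ≠ q.1) ∧
        (∀ p ∈ e.2, ∀ q ∈ e.2, (hF.mapDecomposition D).part e.1 p.1 p.2 =
          (hF.mapDecomposition D).part e.1 q.1 q.2) ∧
        ∑ p ∈ e.2, (hF.mapDecomposition D).part e.1 p.1 p.2 = 0)) ↔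
      ((∃ p q : Fin m × ℕ, p.1 ≠ q.1 ∧ e.2 = {p, q} ∧
        D.part e.1 p.1 p.2 = -D.part e.1 q.1 q.2) ∨
      (3 ≤ e.2.card ∧ (∃ p ∈ e.2, ∃ q ∈ e.2, p.1 ≠ q.1) ∧
        (∀ p ∈ e.2, ∀ q ∈ e.2, D.part e.1 p.1 p.2 = D.part e.1 q.1 q.2) ∧
        ∑ p ∈ e.2, D.part e.1 p.1 p.2 = 0)) := by
    intro e
    simp only [mapDecomposition, ← map_neg, ← map_sum, hF.injective.eq_iff,
      map_eq_zero_iff F hF.injective]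
  constructor
  · exact fun h => ⟨h.index_lt, fun e he => (key e).1 (h.edge_or_hyperedge e he),
      h.label_disjoint⟩
  · exact fun h => ⟨h.index_lt, fun e he => (key e).2 (h.edge_or_hyperedge e he),
      h.label_disjoint⟩

theorem isInductive_map (hF : IsPathEmbedding G G' s s' F) {n : ℤ} {E₁ E₂ : Set (Chains V R)}
    {E₁' E₂' : Set (Chains V R')} (h₁ : ∀ x ∈ E₁, F x ∈ E₁') (h₂ : ∀ x ∈ E₂, F x ∈ E₂')
    {y : Chains V R} (hy : IsInductive G R s n E₁ E₂ y) :
    IsInductive G' R' s' n E₁' E₂' (F y) := by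
  obtain ⟨hyΩ, v, hv, m, x, D, E, hE, hconn, hext, hcomp, rfl, hx, hpart⟩ := hy
  refine ⟨hF.mem_omega _ _ hyΩ, v, by rw [hF.endSet_map, hv], m, fun i => F (x i),
    hF.mapDecomposition D, E, (hF.isFaceMultihypergraph_iff D E).2 hE, ?_, ?_, ?_, ?_, ?_, ?_⟩
  · intro E' h
    refine hconn E' (h.mono fun A B hAB => ?_)
    rwa [hF.isFaceMultihypergraph_iff, hF.isFaceMultihypergraph_iff] at hAB
  · intro i w hw
    rw [hF.endSet_map] at hw
    exact (hF.joins_iff _ _).2 (hext i w hw)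
  · refine ⟨fun e he => ?_, fun i u hu huv hj => ?_⟩
    · rw [hF.joins_iff]; exact hcomp.1 e he
    · refine hcomp.2 i u (fun h => hu ?_) huv (fun h => hj ((hF.joins_iff _ _).2 h))
      rw [hF.face_map, h, map_zero]
  · rw [← map_sum, hF.extend_map]
  · intro i
    exact (hx i).imp (h₁ _) (fun h => by rw [← map_neg]; exact h₁ _ h)
  · intro u i k hk
    refine (hpart u i k hk).imp (h₂ _) (fun h => ?_)
    simpa [mapDecomposition] using h₂ _ h

theorem mem_inductiveElements (hF : IsPathEmbedding G G' s s' F) (n : ℕ) {y : Chains V R}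
    (hy : y ∈ inductiveElements G R s n) : F y ∈ inductiveElements G' R' s' n := by
  induction n using Nat.strong_induction_on generalizing y with
  | _ n ih =>
    match n with
    | 0 =>
      obtain ⟨v, rfl | rfl⟩ := hy
      · exact ⟨v, .inl (hF.path_map v)⟩
      · exact ⟨v, .inr (by rw [map_neg, hF.path_map v])⟩
    | 1 =>
      exact hF.isInductive_map (fun x hx => ih 0 (by omega) hx) (fun x hx => hx.elim) hy
    | n + 2 =>
      exact hF.isInductive_map (fun x hx => ih (n + 1) (by omega) hx)
        (fun x hx => ih n (by omega) hx) hy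

end IsPathEmbedding

theorem linearMap_eq_of_mem_supported {V R M : Type*} [CommRing R] [AddCommGroup M] [Module R M]
    {f g : Chains V R →ₗ[R] M} {s : Set (List V)} (h : ∀ l ∈ s, f (path R l) = g (path R l))
    {x : Chains V R} (hx : x ∈ Finsupp.supported R R s) : f x = g x := by
  rw [Finsupp.supported_eq_span_single] at hx
  refine LinearMap.eqOn_span ?_ hx
  rintro _ ⟨l, hl, rfl⟩
  exact h l hl

theorem mapsTo_of_mem_supported {V R M : Type*} [CommRing R] [AddCommGroup M] [Module R M]
    {f : Chains V R →ₗ[R] M} {s : Set (List V)} {N : Submodule R M}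
    (h : ∀ l ∈ s, f (path R l) ∈ N) {x : Chains V R} (hx : x ∈ Finsupp.supported R R s) :
    f x ∈ N := by
  rw [Finsupp.supported_eq_span_single] at hx
  have : Submodule.span R ((fun i => Finsupp.single i (1 : R)) '' s) ≤ N.comap f := by
    rw [Submodule.span_le]
    rintro _ ⟨l, hl, rfl⟩
    exact h l hl
  exact this hx

/-! ### Change of coefficients -/

section Coefficients

variable {V R R' : Type*} [CommRing R] [CommRing R']

/-- The change of coefficients along an additive map. -/
noncomputable def mapCoeff (V : Type*) {R R' : Type*} [CommRing R] [CommRing R'] (φ : R →+ R') :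
    Chains V R →+ Chains V R' :=
  Finsupp.mapRange.addMonoidHom φ

@[simp] theorem mapCoeff_apply (φ : R →+ R') (x : Chains V R) (l : List V) :
    mapCoeff V φ x l = φ (x l) := by
  simp [mapCoeff]

@[simp] theorem mapCoeff_single (φ : R →+ R') (l : List V) (a : R) :
    mapCoeff V φ (Finsupp.single l a) = Finsupp.single l (φ a) := by
  simp [mapCoeff]

/-- With integer signs the boundary commutes with every additive map of coefficients, not only with
ring homomorphisms. This is what allows the coordinate maps K → ℚ later. -/
theorem neg_one_pow_smul_single (i : ℕ) (l : List V) (a : R) :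
    ((-1 : R) ^ i • Finsupp.single l a : Chains V R) = (-1 : ℤ) ^ i • Finsupp.single l a := by
  rcases neg_one_pow_eq_or R i with h | h <;> rcases Nat.even_or_odd i with h' | h' <;>
    simp [h'.neg_one_pow]

theorem boundary_single (l : List V) (a : R) :
    boundary V R (Finsupp.single l a) = if 2 ≤ l.length then
      ∑ i ∈ Finset.range l.length, (-1 : ℤ) ^ i • Finsupp.single (l.eraseIdx i) a else 0 := by
  rw [boundary, Finsupp.linearCombination_single]
  split_ifs with h
  · rw [Finset.smul_sum]
    refine Finset.sum_congr rfl fun i _ => ?_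
    rw [path, smul_comm, Finsupp.smul_single_one, neg_one_pow_smul_single]
  · simp

theorem boundary_mapCoeff (φ : R →+ R') (x : Chains V R) :
    boundary V R' (mapCoeff V φ x) = mapCoeff V φ (boundary V R x) := by
  induction x using Finsupp.induction_linear with
  | zero => simp
  | add f g hf hg => simp [hf, hg]
  | single l a =>
    rw [mapCoeff_single, boundary_single, boundary_single]
    split_ifs
    · rw [map_sum]
      exact Finset.sum_congr rfl fun i _ => by rw [map_zsmul, mapCoeff_single]
    · simp

theorem face_mapCoeff (φ : R →+ R') (s : Side) (u : V) (x : Chains V R) :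
    face R' s u (mapCoeff V φ x) = mapCoeff V φ (face R s u x) := by
  induction x using Finsupp.induction_linear with
  | zero => simp
  | add f g hf hg => simp [hf, hg]
  | single l a => 
    rw [mapCoeff_single, face, face, Finsupp.linearCombination_single,
      Finsupp.linearCombination_single]
    split_ifs <;> simp [path]

theorem extend_mapCoeff (G : Digraph V) (φ : R →+ R') (s : Side) (v : V) (x : Chains V R) :
    extend G R' s v (mapCoeff V φ x) = mapCoeff V φ (extend G R s v x) := by
  induction x using Finsupp.induction_linear with
  | zero => simp
  | add f g hf hg => simp [hf, hg]
  | single l a =>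
    rw [mapCoeff_single, extend, extend, Finsupp.linearCombination_single,
      Finsupp.linearCombination_single]
    split_ifs <;> simp [path]

theorem mapCoeff_mem_supported (φ : R →+ R') {s : Set (List V)} {x : Chains V R}
    (hx : x ∈ Finsupp.supported R R s) : mapCoeff V φ x ∈ Finsupp.supported R' R' s := by
  rw [Finsupp.mem_supported'] at hx ⊢
  intro l hl
  simp [hx l hl]

theorem mapCoeff_mem_Omega (G : Digraph V) (φ : R →+ R') {n : ℤ} {x : Chains V R}
    (hx : x ∈ Omega G R n) : mapCoeff V φ x ∈ Omega G R' n := by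
  obtain ⟨h1, h2⟩ := hx
  refine ⟨mapCoeff_mem_supported φ h1, ?_⟩
  obtain ⟨a, ha, b, hb, hab⟩ := Submodule.mem_sup.1 h2
  rw [SetLike.mem_coe, Submodule.mem_comap, boundary_mapCoeff, ← hab, map_add]
  exact Submodule.add_mem_sup (mapCoeff_mem_supported φ ha) (mapCoeff_mem_supported φ hb)

theorem isPathEmbedding_mapCoeff (G : Digraph V) (s : Side) (φ : R →+* R')
    (hφ : Function.Injective φ) : IsPathEmbedding G G s s (mapCoeff V φ.toAddMonoidHom) where
  injective := Finsupp.mapRange_injective _ (map_zero _) hφ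
  mem_omega _ _ h := mapCoeff_mem_Omega G _ h
  face_map := face_mapCoeff _ s
  extend_map := extend_mapCoeff G _ s
  endSet_map x := by
    have : ∀ r, φ r = 0 ↔ r = 0 := fun r => map_eq_zero_iff φ hφ
    simp [endSet, this]
  joins_iff _ _ := Iff.rfl
  path_map v := by simp [path]

theorem ofInt_eq_mapCoeff (K : Type*) [CommRing K] (x : Chains V ℤ) :
    ofInt K x = mapCoeff V (Int.castRingHom K).toAddMonoidHom x := by
  ext l
  simp [ofInt]

end Coefficients

/-! ### From integral generators to bases over a field of characteristic zero -/

section Field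

variable {V : Type*} (K : Type*) [Field K] [CharZero K]

theorem exists_integer_multiple (w : Chains V ℚ) :
    ∃ N : ℤ, N ≠ 0 ∧ ∃ z : Chains V ℤ, N • w = ofInt ℚ z := by
  induction w using Finsupp.induction_linear with
  | zero => exact ⟨1, one_ne_zero, 0, by simp [ofInt]⟩
  | add f g hf hg =>
    obtain ⟨N, hN, z, hz⟩ := hf
    obtain ⟨N', hN', z', hz'⟩ := hg
    refine ⟨N * N', mul_ne_zero hN hN', N' • z + N • z', ?_⟩
    rw [ofInt_eq_mapCoeff] at hz hz' ⊢
    rw [map_add, map_zsmul, map_zsmul, ← hz, ← hz', smul_add, mul_comm N N', mul_smul,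
      mul_comm N' N, mul_smul]
  | single l a =>
    refine ⟨a.den, by exact_mod_cast a.den_ne_zero, Finsupp.single l a.num, ?_⟩
    rw [ofInt_eq_mapCoeff, mapCoeff_single, Finsupp.smul_single]
    congr 1
    simp [Rat.den_mul_eq_num]

theorem mem_allowed_sup_irregular_iff {R : Type*} [CommRing R] (G : Digraph V) (n : ℤ)
    (x : Chains V R) : x ∈ allowed G R n ⊔ irregular V R n ↔
      ∀ l, ¬ (l ≠ [] ∧ (l.length : ℤ) = n + 1 ∧ l.IsChain G.Adj ∨
        (l.length : ℤ) = n + 1 ∧ ¬ l.IsChain (· ≠ ·)) → x l = 0 := by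
  rw [allowed, irregular, ← Finsupp.supported_union, Finsupp.mem_supported']
  rfl

/-- Membership in Ω_n means that certain coefficients of the chain and of its boundary vanish, and ℤ
→ K reflects vanishing. -/
theorem mem_Omega_of_ofInt_mem (G : Digraph V) {n : ℤ} {x : Chains V ℤ}
    (hx : ofInt K x ∈ Omega G K n) : x ∈ Omega G ℤ n := by
  rw [ofInt_eq_mapCoeff] at hx
  obtain ⟨h1, h2⟩ := hx
  refine ⟨?_, ?_⟩
  · rw [SetLike.mem_coe, allowed, Finsupp.mem_supported'] at h1 ⊢
    intro l hl
    simpa using h1 l hl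
  · rw [SetLike.mem_coe, Submodule.mem_comap, mem_allowed_sup_irregular_iff] at h2 ⊢
    intro l hl
    simpa [boundary_mapCoeff] using h2 l hl

/-- Expand the coefficients of x in a basis of K over ℚ. Each coordinate chain stays in Ω_n, as the
coordinate maps are additive, and it becomes integral after clearing denominators. -/
theorem Omega_eq_span_ofInt (G : Digraph V) (n : ℤ) :
    Omega G K n = Submodule.span K (ofInt K '' (Omega G ℤ n : Set (Chains V ℤ))) := by
  apply le_antisymm
  · intro x hx
    let b := Module.Basis.ofVectorSpace ℚ K
    let φ j : K →+ ℚ := (b.coord j).toAddMonoidHom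
    have hφ : ∀ j r, φ j r = b.repr r j := fun j r => rfl
    have hj : ∀ j, mapCoeff V (algebraMap ℚ K).toAddMonoidHom (mapCoeff V (φ j) x) ∈
        Submodule.span K (ofInt K '' (Omega G ℤ n : Set (Chains V ℤ))) := by
      intro j
      obtain ⟨N, hN, z, hz⟩ := exists_integer_multiple (mapCoeff V (φ j) x)
      have hzΩ : z ∈ Omega G ℤ n := by
        apply mem_Omega_of_ofInt_mem ℚ
        rw [← hz]
        exact zsmul_mem (mapCoeff_mem_Omega G (φ j) hx) N
      have : mapCoeff V (algebraMap ℚ K).toAddMonoidHom (mapCoeff V (φ j) x) =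
          (N : K)⁻¹ • ofInt K z := by
        rw [eq_inv_smul_iff₀ (by exact_mod_cast hN)]
        ext l
        have := DFunLike.congr_fun hz l
        simp [ofInt] at this ⊢
        rw [← Rat.cast_intCast (α := K), ← Rat.cast_mul, this]
        simp
      rw [this]
      exact Submodule.smul_mem _ _ (Submodule.subset_span ⟨z, hzΩ, rfl⟩)
    classical
    -- Only finitely many basis vectors of K over ℚ occur in the coefficients of x.
    let J := x.support.biUnion fun l => (b.repr (x l)).support
    have hsum : x = ∑ j ∈ J, b j •
        mapCoeff V (algebraMap ℚ K).toAddMonoidHom (mapCoeff V (φ j) x) := by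
      ext l
      rw [Finsupp.finsetSum_apply]
      by_cases hl : x l = 0
      · simp [hl]
      · conv_lhs => rw [← b.linearCombination_repr (x l), Finsupp.linearCombination_apply,
          Finsupp.sum]
        rw [Finset.sum_subset (s₂ := J)]
        · refine Finset.sum_congr rfl fun j _ => ?_
          simp [hφ, Rat.smul_def, mul_comm]
        · intro j hj
          exact Finset.mem_biUnion.2 ⟨l, by simpa using hl, hj⟩
        · intro j _ hj
          rw [Finsupp.notMem_support_iff.1 hj, zero_smul]
    rw [hsum]
    exact Submodule.sum_mem _ fun j _ => Submodule.smul_mem _ _ (hj j)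
  · rw [Submodule.span_le]
    rintro _ ⟨z, hz, rfl⟩
    rw [ofInt_eq_mapCoeff]
    exact mapCoeff_mem_Omega G _ hz

/-- Over a field every spanning set contains a basis, so it suffices that the images of the integral
inductive elements span. Over ℤ this selection is not available, so integral bases require an
explicit choice. -/
theorem exists_isBasisOf_of_span_eq (G : Digraph V) (s : Side) (i : ℕ)
    (h : Submodule.span ℤ (inductiveElements G ℤ s i) = Omega G ℤ i) :
    ∃ B ⊆ inductiveElements G K s i ∩ ofInt K '' inductiveElements G ℤ s i,
      IsBasisOf B (Omega G K i) := by
  have hsub : ofInt K '' inductiveElements G ℤ s i ⊆ inductiveElements G K s i := by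
    rintro _ ⟨z, hz, rfl⟩
    rw [ofInt_eq_mapCoeff]
    exact (isPathEmbedding_mapCoeff G s (Int.castRingHom K) Int.cast_injective).mem_inductiveElements
      i hz
  obtain ⟨B, hB, hspan, hind⟩ :=
    exists_linearIndependent K (ofInt K '' inductiveElements G ℤ s i)
  refine ⟨B, fun y hy => ⟨hsub (hB hy), hB hy⟩, hind, ?_⟩
  rw [hspan, Omega_eq_span_ofInt, ← h]
  apply le_antisymm
  · exact Submodule.span_mono (Set.image_mono Submodule.subset_span)
  · rw [Submodule.span_le]
    rintro _ ⟨z, hz, rfl⟩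
    rw [SetLike.mem_coe] at hz ⊢
    induction hz using Submodule.span_induction with
    | mem z hz => exact Submodule.subset_span ⟨z, hz, rfl⟩
    | zero => simp [ofInt]
    | add a b _ _ ha hb =>
      rw [ofInt_eq_mapCoeff] at ha hb ⊢
      rw [map_add]; exact add_mem ha hb
    | smul c a _ ha =>
      rw [ofInt_eq_mapCoeff] at ha ⊢
      rw [map_zsmul]; exact zsmul_mem ha c

end Field

/-! ### Invariants of mutations -/

section Mutation

variable {V : Type*} {G : Digraph V} {R : Type*} [CommRing R] {s : Side} {n : ℤ} {m : ℕ}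
  {x : Fin m → Chains V R}

/-- The terms that lie in a label of a hyperedge. -/
def coveredTerms (E : Set (Label V m)) : Set (V × (Fin m × ℕ)) :=
  {q | ∃ e ∈ E, e.1 = q.1 ∧ q.2 ∈ e.2}

/-- A mutation only redistributes the members of a ∪ b. In the second kind, surjectivity of σ
ensures that all of b is still covered. -/
theorem MutationStep.coveredTerms_eq {E E' : Set (Label V m)} (h : MutationStep E E') :
    coveredTerms E = coveredTerms E' := by
  ext ⟨w, p⟩
  rcases h with ⟨u, a, b, a', b', ha, hb, -, -, -, -, hab, rfl⟩ | ⟨u, a, b, σ, ha, hb, -, -, rfl⟩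
  · have hp : p ∈ a' ∨ p ∈ b' ↔ p ∈ a ∨ p ∈ b := by
      rw [← Finset.mem_union, hab, Finset.mem_union]
    constructor
    · rintro ⟨e, he, rfl, hpe⟩
      by_cases h : e = (u, a) ∨ e = (u, b)
      · have : p ∈ a' ∨ p ∈ b' := hp.2 (by rcases h with rfl | rfl <;> simp_all)
        rcases this with h' | h'
        · exact ⟨(u, a'), by simp, by rcases h with rfl | rfl <;> rfl, h'⟩
        · exact ⟨(u, b'), by simp, by rcases h with rfl | rfl <;> rfl, h'⟩
      · exact ⟨e, .inl ⟨he, h⟩, rfl, hpe⟩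
    · rintro ⟨e, ⟨he, -⟩ | he, rfl, hpe⟩
      · exact ⟨e, he, rfl, hpe⟩
      · have he' : e = (u, a') ∨ e = (u, b') := he
        have : p ∈ a ∨ p ∈ b := hp.1 (by rcases he' with rfl | rfl <;> simp_all)
        rcases this with h' | h'
        · exact ⟨(u, a), ha, by rcases he' with rfl | rfl <;> rfl, h'⟩
        · exact ⟨(u, b), hb, by rcases he' with rfl | rfl <;> rfl, h'⟩
  · constructor
    · rintro ⟨e, he, rfl, hpe⟩
      by_cases h : e = (u, a) ∨ e = (u, b)
      · rcases h with rfl | rfl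
        · exact ⟨_, .inr ⟨⟨p, hpe⟩, rfl⟩, rfl, by simp⟩
        · exact ⟨_, .inr ⟨σ.symm ⟨p, hpe⟩, rfl⟩, rfl, by simp⟩
      · exact ⟨e, .inl ⟨he, h⟩, rfl, hpe⟩
    · rintro ⟨e, ⟨he, -⟩ | ⟨q, rfl⟩, rfl, hpe⟩
      · exact ⟨e, he, rfl, hpe⟩
      · rcases Finset.mem_insert.1 hpe with rfl | h
        · exact ⟨_, ha, rfl, q.2⟩
        · rw [Finset.mem_singleton] at h
          subst h
          exact ⟨_, hb, rfl, (σ q).2⟩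

theorem MutationEquivalent.coveredTerms_eq {D : FaceDecomposition G R s n x}
    {E E' : Set (Label V m)} (h : MutationEquivalent D E E') :
    coveredTerms E = coveredTerms E' := by
  induction h with
  | rel _ _ h => exact h.2.2.coveredTerms_eq
  | refl _ => rfl
  | symm _ _ _ h => exact h.symm
  | trans _ _ _ _ _ h h' => exact h.trans h'

/-- An equivalence is the right form, since the generated relation also relates to itself a set of
labels that is not a face multihypergraph. -/
theorem MutationEquivalent.isFaceMultihypergraph_iff {D : FaceDecomposition G R s n x}
    {E E' : Set (Label V m)} (h : MutationEquivalent D E E') :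
    IsFaceMultihypergraph D E ↔ IsFaceMultihypergraph D E' := by
  induction h with
  | rel _ _ h => exact iff_of_true h.1 h.2.1
  | refl _ => rfl
  | symm _ _ _ h => exact h.symm
  | trans _ _ _ _ _ h h' => exact h.trans h'

/-- The terms of a label sum to zero, if it is a hyperedge or an edge. -/
theorem IsFaceMultihypergraph.sum_label {D : FaceDecomposition G R s n x}
    {E : Set (Label V m)} (hE : IsFaceMultihypergraph D E) {e : Label V m} (he : e ∈ E) :
    ∑ p ∈ e.2, D.part e.1 p.1 p.2 = 0 := by
  rcases hE.edge_or_hyperedge e he with ⟨p, q, hpq, h, hD⟩ | h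
  · rw [h, Finset.sum_pair (fun h => hpq (by rw [h])), hD, neg_add_cancel]
  · exact h.2.2.2

/-- The sum of the faces over a union of connected components vanishes, where all terms are
covered. -/
theorem IsFaceMultihypergraph.sum_face_eq_zero {D : FaceDecomposition G R s n x}
    {E : Set (Label V m)} (hE : IsFaceMultihypergraph D E) {u : V} (S : Finset (Fin m))
    (hS : ∀ e ∈ E, ∀ p ∈ e.2, ∀ q ∈ e.2, p.1 ∈ S → q.1 ∈ S)
    (hu : ∀ i, ∀ k < D.mult u i, (u, (i, k)) ∈ coveredTerms E) :
    ∑ i ∈ S, face R s u (x i) = 0 := by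
  classical
  simp only [← D.sum_part]
  rw [Finset.sum_sigma']
  let T : Finset (Σ _ : Fin m, ℕ) := S.sigma fun i => Finset.range (D.mult u i)
  have hT : ∀ p ∈ T, ∃ e ∈ E, e.1 = u ∧ (p.1, p.2) ∈ e.2 := fun p hp =>
    hu p.1 p.2 (Finset.mem_range.1 (Finset.mem_sigma.1 hp).2)
  have : Nonempty (Label V m) := ⟨(u, ∅)⟩
  -- Group the terms by a label `g p` containing them. Labels with the same u are disjoint and
  -- closed under S, so each fibre of g is a full label and sums to zero.
  choose! g hgE hgu hg using hT
  change ∑ p ∈ T, D.part u p.1 p.2 = 0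
  have hmaps : ∀ p ∈ T, g p ∈ T.image g := fun p hp => Finset.mem_image_of_mem g hp
  rw [← Finset.sum_fiberwise_of_maps_to hmaps]
  refine Finset.sum_eq_zero fun e he => ?_
  obtain ⟨p₀, hp₀, rfl⟩ := Finset.mem_image.1 he
  have hsum := hE.sum_label (hgE p₀ hp₀)
  rw [hgu p₀ hp₀] at hsum
  rw [← hsum]
  refine Finset.sum_bij (fun p _ => (p.1, p.2)) ?_ ?_ ?_ ?_
  · intro p hp
    obtain ⟨hpT, h⟩ := Finset.mem_filter.1 hp
    rw [← h]; exact hg p hpT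
  · rintro ⟨i, k⟩ _ ⟨j, l⟩ _ h
    simp at h
    obtain ⟨rfl, rfl⟩ := h
    rfl
  · rintro ⟨i, k⟩ hik
    have hmem : (⟨i, k⟩ : Σ _ : Fin m, ℕ) ∈ T := by
      refine Finset.mem_sigma.2 ⟨?_, Finset.mem_range.2 ?_⟩
      · exact hS _ (hgE p₀ hp₀) _ (hg p₀ hp₀) _ hik (Finset.mem_sigma.1 hp₀).1
      · have := hE.index_lt _ (hgE p₀ hp₀) _ hik
        rwa [hgu p₀ hp₀] at this
    refine ⟨⟨i, k⟩, Finset.mem_filter.2 ⟨hmem, ?_⟩, rfl⟩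
    by_contra hne
    exact Finset.disjoint_left.1 (hE.label_disjoint _ (hgE _ hmem) _ (hgE _ hp₀) hne
      (by rw [hgu _ hmem, hgu _ hp₀])) (hg _ hmem) hik
  · intro p _
    rfl

end Mutation

/-! ### Matching signed paths that cancel -/

section Matching

variable {V : Type*}

theorem path_ne_neg_path (l l' : List V) : path ℤ l ≠ -path ℤ l' := by
  classical
  intro h
  have := DFunLike.congr_fun h l
  simp only [path, Finsupp.single_eq_same, Finsupp.neg_apply, Finsupp.single_apply] at this
  split_ifs at this
  all_goals omega

theorem path_injective : Function.Injective (path ℤ : List V → Chains V ℤ) :=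
  Finsupp.single_left_injective one_ne_zero

theorem path_ne_zero (l : List V) : path ℤ l ≠ 0 := by simp [path]

/-- Signed elementary paths with sum zero can be matched such that partners cancel. -/
theorem exists_matching {ι : Type*} [Finite ι] (f : ι → Chains V ℤ)
    (hf : ∀ i, f i = 0 ∨ ∃ l, f i = path ℤ l ∨ f i = -path ℤ l)
    (hsum : ∑ᶠ i, f i = 0) :
    ∃ σ : {i // ∃ l, f i = path ℤ l} ≃ {i // ∃ l, f i = -path ℤ l},
      ∀ i, f (σ i) = -f i := by
  classical
  have := Fintype.ofFinite ι
  rw [finsum_eq_sum_of_fintype] at hsum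
  -- The coefficient of l in the total sum is the number of terms +l minus the number of terms −l.
  have hcard : ∀ l : List V, (Finset.univ.filter fun i => f i = path ℤ l).card =
      (Finset.univ.filter fun i => f i = -path ℤ l).card := by
    intro l
    have h := DFunLike.congr_fun hsum l
    rw [Finsupp.finsetSum_apply, Finsupp.zero_apply] at h
    have hval : ∀ i, f i l = (if f i = path ℤ l then (1 : ℤ) else 0) -
        (if f i = -path ℤ l then 1 else 0) := by
      intro i
      rcases hf i with h0 | ⟨l', h0 | h0⟩
      · have h1 : (0 : Chains V ℤ) ≠ path ℤ l := (path_ne_zero l).symm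
        have h2 : (0 : Chains V ℤ) ≠ -path ℤ l := fun h => path_ne_zero l (by
          rw [← neg_eq_zero, ← h])
        simp [h0, h1, h2]
      · rw [h0, if_neg (path_ne_neg_path l' l), sub_zero]
        simp only [path_injective.eq_iff]
        rw [path, Finsupp.single_apply]
      · rw [h0, if_neg (fun h => path_ne_neg_path l l' h.symm)]
        rw [zero_sub]
        simp only [neg_inj, path_injective.eq_iff]
        rw [path, Finsupp.neg_apply, Finsupp.single_apply]
    simp only [hval, Finset.sum_sub_distrib, Finset.sum_boole] at h
    exact_mod_cast sub_eq_zero.1 h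
  -- The bijection is assembled over the common value c of f on one side and −f on the other; both
  -- fibres are empty unless c is an elementary path.
  have hfib : ∀ c : Chains V ℤ,
      Nonempty ({a : {i // ∃ l, f i = path ℤ l} // f a = c} ≃
        {b : {i // ∃ l, f i = -path ℤ l} // -f b = c}) := by
    intro c
    by_cases hc : ∃ l, c = path ℤ l
    · obtain ⟨l, rfl⟩ := hc
      have e1 : {a : {i // ∃ l, f i = path ℤ l} // f a = path ℤ l} ≃ {i // f i = path ℤ l} :=
        Equiv.subtypeSubtypeEquivSubtype (p := fun i => ∃ l, f i = path ℤ l)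
          (q := fun i => f i = path ℤ l) (fun h => ⟨l, h⟩)
      have e2 : {a : {i // ∃ l, f i = -path ℤ l} // -f a = path ℤ l} ≃
          {i // f i = -path ℤ l} :=
        (Equiv.subtypeSubtypeEquivSubtype (p := fun i => ∃ l, f i = -path ℤ l)
          (q := fun i => -f i = path ℤ l) (fun h => ⟨l, by rw [← h, neg_neg]⟩)).trans
          (Equiv.subtypeEquivRight fun i => by rw [neg_eq_iff_eq_neg])
      have e3 : Nonempty ({i // f i = path ℤ l} ≃ {i // f i = -path ℤ l}) := by
        rw [← Fintype.card_eq, Fintype.card_subtype, Fintype.card_subtype, hcard]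
      exact e3.map fun e => (e1.trans e).trans e2.symm
    · refine ⟨@Equiv.equivOfIsEmpty _ _ ⟨?_⟩ ⟨?_⟩⟩
      · rintro ⟨⟨i, l, h⟩, h'⟩
        exact hc ⟨l, by rw [← h', ← h]⟩
      · rintro ⟨⟨i, l, h⟩, h'⟩
        exact hc ⟨l, by rw [← h']; simp [h]⟩
  refine ⟨Equiv.ofFiberEquiv (f := fun a => f a.1) (g := fun b => -f b.1)
    fun c => (hfib c).some, fun i => ?_⟩
  rw [← Equiv.ofFiberEquiv_map (f := fun a : {i // ∃ l, f i = path ℤ l} => f a.1)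
    (g := fun b : {i // ∃ l, f i = -path ℤ l} => -f b.1) (fun c => (hfib c).some) i, neg_neg]

end Matching

/-! ### Minimal cancelling families give inductive elements -/

section Irreducible

variable {V : Type*} {G : Digraph V} {s : Side} {n : ℤ}

theorem endSet_extend {R : Type*} [CommRing R] {v : V} {z : Chains V R}
    (hz : extend G R s v z ≠ 0) : endSet s (extend G R s v z) = {v} := by
  have hsupp : extend G R s v z ∈ Finsupp.supported R R {l | s.endpoint l = some v} := by
    refine mapsTo_of_mem_supported (s := Set.univ) (fun l _ => ?_) (by simp)
    rw [extend, path, Finsupp.linearCombination_single, one_smul]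
    split_ifs
    · refine Finsupp.single_mem_supported R _ ?_
      cases s <;> simp [Side.endpoint, Side.add]
    · exact zero_mem _
  rw [Finsupp.mem_supported] at hsupp
  obtain ⟨l, hl⟩ := Finsupp.support_nonempty_iff.2 hz
  ext w
  constructor
  · rintro ⟨l', hl', h⟩
    have h' : s.endpoint l' = some v := hsupp hl'
    rw [h, Option.some_inj] at h'
    exact h'
  · rintro rfl
    exact ⟨l, hl, hsupp hl⟩

/-- A vertex `u` is blocked for `v` if paths through `u` that end at `v` are regular and not
allowed. -/
def IsBlocked (G : Digraph V) (s : Side) (v u : V) : Prop := ¬ s.Joins G u v ∧ u ≠ v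

open scoped Classical in
/-- The face decomposition of a family each of whose faces is zero or an elementary path up to
sign. -/
noncomputable def simpleDecomposition {m : ℕ} {x : Fin m → Chains V ℤ}
    (hΩ : ∀ i, x i ∈ Omega G ℤ n) (hneg : ∀ i j, i ≠ j → x i ≠ -x j)
    (hface : ∀ i u, face ℤ s u (x i) ∈ Omega G ℤ (n - 1)) :
    FaceDecomposition G ℤ s n x where
  vertex_mem := hΩ
  vertex_ne_neg := hneg
  mult u i := if face ℤ s u (x i) = 0 then 0 else 1
  part u i _ := face ℤ s u (x i)
  part_mem u i _ _ := hface i u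
  sum_part u i := by
    split_ifs with h
    · simp [h]
    · simp
  sum_ne_zero u i T hT hT' := by
    split_ifs at hT with h
    · simp only [Finset.range_zero, Finset.subset_empty] at hT
      exact absurd hT' (by simp [hT])
    · rw [Finset.range_one, hT'.subset_singleton_iff] at hT
      simpa [hT] using h

/-- Any matching of the blocked faces works: minimality alone forces connectedness, for the chosen
hypergraph and for all its mutations. -/
theorem isInductive_of_irreducible_fin {E₁ E₂ : Set (Chains V ℤ)} {v : V} {m : ℕ}
    {x : Fin m → Chains V ℤ} (hΩ : ∀ i, x i ∈ Omega G ℤ (n - 1))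
    (hneg : ∀ i j, i ≠ j → x i ≠ -x j) (hE₁ : ∀ i, x i ∈ E₁ ∨ -x i ∈ E₁)
    (hface : ∀ i u, face ℤ s u (x i) = 0 ∨ ∃ l, path ℤ l ∈ E₂ ∧ path ℤ l ∈ Omega G ℤ (n - 1 - 1) ∧
      (face ℤ s u (x i) = path ℤ l ∨ face ℤ s u (x i) = -path ℤ l))
    (hext : ExtendsBy G s x v)
    (hsum : ∀ u, IsBlocked G s v u → ∑ i, face ℤ s u (x i) = 0)
    (hirr : ∀ S : Finset (Fin m), S.Nonempty →
      (∀ u, IsBlocked G s v u → ∑ i ∈ S, face ℤ s u (x i) = 0) → S = Finset.univ)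
    (hy : extend G ℤ s v (∑ i, x i) ∈ Omega G ℤ n)
    (hend : endSet s (extend G ℤ s v (∑ i, x i)) = {v}) :
    IsInductive G ℤ s n E₁ E₂ (extend G ℤ s v (∑ i, x i)) := by
  classical
  have hmatch : ∀ u, IsBlocked G s v u →
      ∃ σ : {i // ∃ l, face ℤ s u (x i) = path ℤ l} ≃ {i // ∃ l, face ℤ s u (x i) = -path ℤ l},
      ∀ i, face ℤ s u (x (σ i)) = -face ℤ s u (x i) := fun u hu =>
    exists_matching (fun i => face ℤ s u (x i))
      (fun i => (hface i u).imp id fun ⟨l, _, _, h⟩ => ⟨l, h⟩)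
      (by rw [finsum_eq_sum_of_fintype, hsum u hu])
  choose σ hσ using hmatch
  let D : FaceDecomposition G ℤ s (n - 1) x := simpleDecomposition hΩ hneg (fun i u => by
    rcases hface i u with h | ⟨l, -, h, h' | h'⟩
    · rw [h]; exact zero_mem _
    · rwa [h']
    · rw [h']; exact neg_mem h)
  have hDpart : ∀ u i k, D.part u i k = face ℤ s u (x i) := fun _ _ _ => rfl
  have hDmult : ∀ u i, D.mult u i = if face ℤ s u (x i) = 0 then 0 else 1 := fun _ _ => rfl
  have hDlt : ∀ u i k, k < D.mult u i ↔ k = 0 ∧ face ℤ s u (x i) ≠ 0 := by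
    intro u i k
    rw [hDmult]
    split_ifs with h <;> simp [h]
  -- Edges alone suffice. Each nonzero face is its own single term, so the second index is always 0.
  let E : Set (Label V m) := {e | ∃ (u : V) (hu : IsBlocked G s v u)
    (i : {i // ∃ l, face ℤ s u (x i) = path ℤ l}),
    e = (u, {((i : Fin m), 0), ((σ u hu i : Fin m), 0)})}
  have hE : IsFaceMultihypergraph D E := by
    refine ⟨?_, ?_, ?_⟩
    · rintro _ ⟨u, hu, i, rfl⟩ p hp
      rw [hDlt]
      obtain ⟨l, hl⟩ := i.2
      obtain ⟨l', hl'⟩ := (σ u hu i).2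
      rcases Finset.mem_insert.1 hp with rfl | hp
      · exact ⟨rfl, by rw [hl]; exact path_ne_zero l⟩
      · rw [Finset.mem_singleton.1 hp]
        exact ⟨rfl, by rw [hl']; exact neg_ne_zero.2 (path_ne_zero l')⟩
    · rintro _ ⟨u, hu, i, rfl⟩
      refine .inl ⟨_, _, ?_, rfl, ?_⟩
      · intro h
        obtain ⟨l, hl⟩ := i.2
        obtain ⟨l', hl'⟩ := (σ u hu i).2
        refine path_ne_neg_path l l' ?_
        rw [← hl, ← hl']
        exact congrArg (fun i => face ℤ s u (x i)) h
      · rw [hDpart, hDpart, hσ, neg_neg]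
    · rintro _ ⟨u, hu, i, rfl⟩ _ ⟨w, hw, j, rfl⟩ hne (rfl : u = w)
      have hij : i ≠ j := fun h => hne (by rw [h])
      have hpm : ∀ (i : {i // ∃ l, face ℤ s u (x i) = path ℤ l})
          (j : {i // ∃ l, face ℤ s u (x i) = -path ℤ l}), (i : Fin m) ≠ j := by
        rintro ⟨i, l, hl⟩ ⟨j, l', hl'⟩ (rfl : i = j)
        exact path_ne_neg_path l l' (hl.symm.trans hl')
      have h1 : (i : Fin m) ≠ j := fun h => hij (Subtype.ext h)
      have h2 : (σ u hu i : Fin m) ≠ σ u hu j := fun h =>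
        hij ((σ u hu).injective (Subtype.ext h))
      simp [h1.symm, h2.symm, hpm, (hpm _ _).symm]
  -- The covered terms are exactly those at blocked vertices. This gives completeness and survives
  -- mutation.
  have hcover : ∀ q : V × (Fin m × ℕ), q ∈ coveredTerms E ↔
      IsBlocked G s v q.1 ∧ q.2.2 < D.mult q.1 q.2.1 := by
    rintro ⟨u, i, k⟩
    constructor
    · rintro ⟨e, he, rfl, hp⟩
      obtain ⟨w, hw, j, rfl⟩ := id he
      exact ⟨hw, hE.index_lt _ he _ hp⟩
    · rintro ⟨hu, hk⟩
      obtain ⟨rfl, h0⟩ := (hDlt u i k).1 hk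
      rcases hface i u with h | ⟨l, -, -, h | h⟩
      · exact absurd h h0
      · exact ⟨_, ⟨u, hu, ⟨i, l, h⟩, rfl⟩, rfl, by simp⟩
      · exact ⟨_, ⟨u, hu, (σ u hu).symm ⟨i, l, h⟩, rfl⟩, rfl, by simp⟩
  refine ⟨hy, v, hend, m, x, D, E, hE, ?_, hext, ⟨by rintro _ ⟨u, hu, i, rfl⟩; exact hu, ?_⟩, rfl, hE₁, ?_⟩
  · intro E' hEE' i j
    have hE' := hEE'.isFaceMultihypergraph_iff.1 hE
    let r : Fin m → Fin m → Prop := fun i j => ∃ e ∈ E', ∃ p ∈ e.2, ∃ q ∈ e.2, p.1 = i ∧ q.1 = j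
    -- The vertices reachable from i are closed under the labels of E', so their blocked faces
    -- cancel; by minimality they are all vertices.
    have hS := hirr (Finset.univ.filter (Relation.ReflTransGen r i))
      ⟨i, by simpa using Relation.ReflTransGen.refl⟩ (fun u hu => by
        refine hE'.sum_face_eq_zero _ ?_ ?_
        · intro e he p hp q hq hpi
          rw [Finset.mem_filter] at hpi ⊢
          exact ⟨Finset.mem_univ _, hpi.2.tail ⟨e, he, p, hp, q, hq, rfl, rfl⟩⟩
        · intro i k hk
          rw [← hEE'.coveredTerms_eq, hcover]
          exact ⟨hu, hk⟩)
    have := Finset.mem_univ j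
    rw [← hS, Finset.mem_filter] at this
    exact this.2
  · intro i u _ huv hj k hk
    exact (hcover (u, i, k)).2 ⟨⟨hj, huv⟩, hk⟩
  · intro u i k hk
    rw [hDpart]
    rcases hface i u with h | ⟨l, h, -, h' | h'⟩
    · exact absurd h ((hDlt u i k).1 hk).2
    · rw [h']; exact .inl h
    · rw [h', neg_neg]; exact .inr h

theorem isInductive_of_irreducible {ι : Type*} {E₁ E₂ : Set (Chains V ℤ)} {v : V} (A : Finset ι)
    {x : ι → Chains V ℤ} (hΩ : ∀ i ∈ A, x i ∈ Omega G ℤ (n - 1))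
    (hneg : ∀ i ∈ A, ∀ j ∈ A, i ≠ j → x i ≠ -x j) (hE₁ : ∀ i ∈ A, x i ∈ E₁ ∨ -x i ∈ E₁)
    (hface : ∀ i ∈ A, ∀ u, face ℤ s u (x i) = 0 ∨ ∃ l, path ℤ l ∈ E₂ ∧
      path ℤ l ∈ Omega G ℤ (n - 1 - 1) ∧
      (face ℤ s u (x i) = path ℤ l ∨ face ℤ s u (x i) = -path ℤ l))
    (hext : ∀ i ∈ A, ∀ w ∈ endSet s (x i), s.Joins G w v)
    (hsum : ∀ u, IsBlocked G s v u → ∑ i ∈ A, face ℤ s u (x i) = 0)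
    (hirr : ∀ S ⊆ A, S.Nonempty →
      (∀ u, IsBlocked G s v u → ∑ i ∈ S, face ℤ s u (x i) = 0) → S = A)
    (hy : extend G ℤ s v (∑ i ∈ A, x i) ∈ Omega G ℤ n)
    (hend : endSet s (extend G ℤ s v (∑ i ∈ A, x i)) = {v}) :
    IsInductive G ℤ s n E₁ E₂ (extend G ℤ s v (∑ i ∈ A, x i)) := by
  classical
  let e : Fin A.card ≃ A := A.equivFin.symm
  have hsumA : ∀ f : ι → Chains V ℤ, ∑ i ∈ A, f i = ∑ k, f (e k) := fun f => by
    rw [← Finset.sum_coe_sort A f, ← e.sum_comp]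
  simp only [hsumA] at hsum hy hend ⊢
  refine isInductive_of_irreducible_fin (fun k => hΩ _ (e k).2) (fun i j hij => hneg _ (e i).2 _
    (e j).2 fun h => hij (e.injective (Subtype.ext h))) (fun k => hE₁ _ (e k).2)
    (fun k => hface _ (e k).2) (fun k => hext _ (e k).2) hsum ?_ hy hend
  intro S hS h
  let ε : Fin A.card ↪ ι := e.toEmbedding.trans (Function.Embedding.subtype _)
  have hmap := hirr (S.map ε) (fun i hi => by
    obtain ⟨k, -, rfl⟩ := Finset.mem_map.1 hi
    exact (e k).2) (hS.map) (fun u hu => by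
      rw [Finset.sum_map]; exact h u hu)
  rw [Finset.eq_univ_iff_forall]
  intro k
  have : ε k ∈ S.map ε := by rw [hmap]; exact (e k).2
  exact (Finset.mem_map' ε).1 this

/-- A sum of a family whose blocked faces cancel is, after extension, a sum of inductive
elements. -/
theorem extend_sum_mem_span {ι : Type*} {E₁ E₂ : Set (Chains V ℤ)} {v : V}
    {x : ι → Chains V ℤ} (hΩ : ∀ i, x i ∈ Omega G ℤ (n - 1))
    (hneg : ∀ i j, i ≠ j → x i ≠ -x j) (hE₁ : ∀ i, x i ∈ E₁ ∨ -x i ∈ E₁)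
    (hface : ∀ i u, face ℤ s u (x i) = 0 ∨ ∃ l, path ℤ l ∈ E₂ ∧
      path ℤ l ∈ Omega G ℤ (n - 1 - 1) ∧
      (face ℤ s u (x i) = path ℤ l ∨ face ℤ s u (x i) = -path ℤ l))
    (hext : ∀ i, ∀ w ∈ endSet s (x i), s.Joins G w v)
    (hy : ∀ A : Finset ι, (∀ u, IsBlocked G s v u → ∑ i ∈ A, face ℤ s u (x i) = 0) →
      extend G ℤ s v (∑ i ∈ A, x i) ∈ Omega G ℤ n)
    (A : Finset ι) (hsum : ∀ u, IsBlocked G s v u → ∑ i ∈ A, face ℤ s u (x i) = 0) :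
    extend G ℤ s v (∑ i ∈ A, x i) ∈ Submodule.span ℤ {y | IsInductive G ℤ s n E₁ E₂ y} := by
  classical
  induction A using Finset.strongInduction with
  | H A ih =>
    by_cases hirr : ∀ S ⊆ A, S.Nonempty →
      (∀ u, IsBlocked G s v u → ∑ i ∈ S, face ℤ s u (x i) = 0) → S = A
    · by_cases h0 : extend G ℤ s v (∑ i ∈ A, x i) = 0
      · rw [h0]; exact zero_mem _
      refine Submodule.subset_span (isInductive_of_irreducible A (fun i _ => hΩ i)
        (fun i _ j _ => hneg i j) (fun i _ => hE₁ i) (fun i _ => hface i) (fun i _ => hext i)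
        hsum hirr (hy A hsum) ?_)
      exact endSet_extend h0
    -- A proper cancelling subfamily S leaves a cancelling complement, and both are smaller than A.
    · push Not at hirr
      obtain ⟨S, hSA, hS, hSsum, hne⟩ := hirr
      have hsdiff : ∀ f : ι → Chains V ℤ, ∑ i ∈ A, f i = ∑ i ∈ A \ S, f i + ∑ i ∈ S, f i :=
        fun f => (Finset.sum_sdiff hSA).symm
      rw [hsdiff, map_add]
      refine add_mem (ih _ (Finset.sdiff_ssubset hSA hS) fun u hu => ?_)
        (ih _ (hSA.ssubset_of_ne hne) hSsum)
      have := hsum u hu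
      rwa [hsdiff, hSsum u hu, add_zero] at this

end Irreducible

/-! ### Upper inductive elements in dimensions zero to two -/

section Upper

open scoped Classical

variable {V : Type*} {G : Digraph V}

theorem path_mem_allowed {R : Type*} [CommRing R] {n : ℤ} {l : List V} (h0 : l ≠ [])
    (hlen : (l.length : ℤ) = n + 1) (h : l.IsChain G.Adj) : path R l ∈ allowed G R n :=
  Finsupp.single_mem_supported R 1 ⟨h0, hlen, h⟩

theorem path_mem_irregular {R : Type*} [CommRing R] {n : ℤ} {l : List V}
    (hlen : (l.length : ℤ) = n + 1) (h : ¬ l.IsChain (· ≠ ·)) : path R l ∈ irregular V R n :=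
  Finsupp.single_mem_supported R 1 ⟨hlen, h⟩

theorem boundary_path_one (a : V) : boundary V ℤ (path ℤ [a]) = 0 := by
  rw [path, boundary_single]; simp

theorem boundary_path_two (a b : V) :
    boundary V ℤ (path ℤ [a, b]) = path ℤ [b] - path ℤ [a] := by
  rw [path, boundary_single]
  simp [Finset.sum_range_succ, path]
  abel

theorem boundary_path_three (a b c : V) :
    boundary V ℤ (path ℤ [a, b, c]) = path ℤ [b, c] - path ℤ [a, c] + path ℤ [a, b] := by
  rw [path, boundary_single]
  simp [Finset.sum_range_succ, path]
  abel

theorem boundary_path_four (a b c d : V) :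
    boundary V ℤ (path ℤ [a, b, c, d]) =
      path ℤ [b, c, d] - path ℤ [a, c, d] + path ℤ [a, b, d] - path ℤ [a, b, c] := by
  rw [path, boundary_single]
  simp [Finset.sum_range_succ, path, pow_succ]
  abel

theorem face_upper_path_one (u a : V) : face ℤ .upper u (path ℤ [a]) = 0 := by
  simp [face, path, Side.endpoint, Side.truncate]

theorem face_upper_path_two (u a b : V) :
    face ℤ .upper u (path ℤ [a, b]) = if a = u then path ℤ [a] else 0 := by
  simp [face, path, Side.endpoint, Side.truncate]

theorem face_upper_path_three (u a b c : V) :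
    face ℤ .upper u (path ℤ [a, b, c]) = if b = u then path ℤ [a, b] else 0 := by
  simp [face, path, Side.endpoint, Side.truncate]

theorem extend_path_of_isChain {s : Side} {v : V} {l : List V}
    (h : (s.add v l).IsChain G.Adj) : extend G ℤ s v (path ℤ l) = path ℤ (s.add v l) := by
  simp only [extend, path, Finsupp.linearCombination_single, one_smul]
  exact if_pos h

theorem length_and_isChain_of_mem_allowed {n : ℕ} {l : List V}
    (h : l ≠ [] ∧ (l.length : ℤ) = (n : ℤ) + 1 ∧ l.IsChain G.Adj) :
    l.length = n + 1 ∧ l.IsChain G.Adj := ⟨by exact_mod_cast h.2.1, h.2.2⟩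

theorem path_one_mem_Omega (a : V) : path ℤ [a] ∈ Omega G ℤ 0 := by
  refine ⟨path_mem_allowed (by simp) (by simp) (by simp), ?_⟩
  rw [SetLike.mem_coe, Submodule.mem_comap, boundary_path_one]
  exact zero_mem _

theorem path_two_mem_Omega {a b : V} (h : G.Adj a b) : path ℤ [a, b] ∈ Omega G ℤ 1 := by
  refine ⟨path_mem_allowed (by simp) (by simp) (by simpa using h), ?_⟩
  rw [SetLike.mem_coe, Submodule.mem_comap, boundary_path_two]
  refine Submodule.mem_sup_left (sub_mem ?_ ?_) <;>
    exact path_mem_allowed (by simp) (by simp) (by simp)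

theorem Omega_le_allowed (n : ℤ) : Omega G ℤ n ≤ allowed G ℤ n := inf_le_left

theorem endSet_subset_of_mem_supported {R : Type*} [CommRing R] {s : Side} {x : Chains V R} {c : V}
    (hx : x ∈ Finsupp.supported R R {l | s.endpoint l = some c}) {w : V} (hw : w ∈ endSet s x) :
    w = c := by
  obtain ⟨l, hl, hlw⟩ := hw
  have h : s.endpoint l = some c := hx hl
  rw [hlw, Option.some_inj] at h
  exact h

/-- The extension of a single element all of whose blocked faces vanish is inductive. -/
theorem isInductive_extend {s : Side} {n : ℤ} {E₁ E₂ : Set (Chains V ℤ)} {v c : V}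
    {x : Chains V ℤ} (hΩ : x ∈ Omega G ℤ (n - 1)) (hE₁ : x ∈ E₁)
    (hface : ∀ u, face ℤ s u x = 0 ∨ ∃ l, path ℤ l ∈ E₂ ∧ path ℤ l ∈ Omega G ℤ (n - 1 - 1) ∧
      (face ℤ s u x = path ℤ l ∨ face ℤ s u x = -path ℤ l))
    (hc : x ∈ Finsupp.supported ℤ ℤ {l | s.endpoint l = some c}) (hcv : s.Joins G c v)
    (hblocked : ∀ u, IsBlocked G s v u → face ℤ s u x = 0)
    (hy : extend G ℤ s v x ∈ Omega G ℤ n) (hne : extend G ℤ s v x ≠ 0) :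
    IsInductive G ℤ s n E₁ E₂ (extend G ℤ s v x) := by
  have := isInductive_of_irreducible (n := n) (s := s) (G := G) (E₁ := E₁) (E₂ := E₂) (v := v)
    (Finset.univ : Finset Unit) (x := fun _ => x) (fun _ _ => hΩ)
    (fun i _ j _ h => absurd (Subsingleton.elim i j) h) (fun _ _ => .inl hE₁) (fun _ _ => hface)
    (fun _ _ w hw => by rwa [endSet_subset_of_mem_supported hc hw])
    (fun u hu => by simpa using hblocked u hu)
    (fun S _ hS _ => by
      obtain ⟨i, hi⟩ := hS
      exact Finset.eq_univ_iff_forall.2 fun j => by rwa [Subsingleton.elim j i])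
    (by simpa using hy) (by simpa using endSet_extend hne)
  simpa using this

theorem path_two_mem_inductiveElements {a b : V} (h : G.Adj a b) :
    path ℤ [a, b] ∈ inductiveElements G ℤ .upper 1 := by
  have he : extend G ℤ .upper b (path ℤ [a]) = path ℤ [a, b] :=
    extend_path_of_isChain (s := .upper) (by simpa [Side.add] using h)
  have := isInductive_extend (G := G) (s := .upper) (n := 1) (E₂ := ∅) (v := b) (c := a)
    (x := path ℤ [a]) (E₁ := inductiveElements G ℤ .upper 0) (path_one_mem_Omega a) ⟨a, .inl rfl⟩
    (fun u => .inl (face_upper_path_one u a)) (Finsupp.single_mem_supported ℤ 1 (by simp [Side.endpoint]))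
    h (fun u _ => face_upper_path_one u a) (by rw [he]; exact path_two_mem_Omega h)
    (by rw [he]; exact path_ne_zero _)
  rw [he] at this
  exact this

theorem mem_allowed_zero {l : List V} :
    (l ≠ [] ∧ (l.length : ℤ) = (0 : ℕ) + 1 ∧ l.IsChain G.Adj) ↔ ∃ a, l = [a] := by
  constructor
  · intro h
    have := length_and_isChain_of_mem_allowed h
    obtain ⟨a, rfl⟩ := List.length_eq_one_iff.1 this.1
    exact ⟨a, rfl⟩
  · rintro ⟨a, rfl⟩
    simp

theorem mem_allowed_one {l : List V} :
    (l ≠ [] ∧ (l.length : ℤ) = (1 : ℕ) + 1 ∧ l.IsChain G.Adj) ↔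
      ∃ a b, l = [a, b] ∧ G.Adj a b := by
  constructor
  · intro h
    have := length_and_isChain_of_mem_allowed h
    obtain ⟨a, b, rfl⟩ := List.length_eq_two.1 this.1
    exact ⟨a, b, rfl, by simpa using this.2⟩
  · rintro ⟨a, b, rfl, h⟩
    simpa using h

theorem mem_allowed_two {l : List V} :
    (l ≠ [] ∧ (l.length : ℤ) = (2 : ℕ) + 1 ∧ l.IsChain G.Adj) ↔
      ∃ a b c, l = [a, b, c] ∧ G.Adj a b ∧ G.Adj b c := by
  constructor
  · intro h
    have := length_and_isChain_of_mem_allowed h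
    obtain ⟨a, b, c, rfl⟩ := List.length_eq_three.1 this.1
    exact ⟨a, b, c, rfl, by simpa using this.2⟩
  · rintro ⟨a, b, c, rfl, h⟩
    simpa using h

theorem mem_allowed_three {l : List V} :
    (l ≠ [] ∧ (l.length : ℤ) = (3 : ℕ) + 1 ∧ l.IsChain G.Adj) ↔
      ∃ a b c d, l = [a, b, c, d] ∧ G.Adj a b ∧ G.Adj b c ∧ G.Adj c d := by
  constructor
  · intro h
    obtain ⟨h1, h2⟩ := length_and_isChain_of_mem_allowed h
    match l, h1, h2 with
    | [a, b, c, d], _, h2 => exact ⟨a, b, c, d, rfl, by simpa using h2⟩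
  · rintro ⟨a, b, c, d, rfl, h⟩
    simpa using h

theorem isBasisOf_range {ι : Type*} {M : Submodule ℤ (Chains V ℤ)} (f : ι → Chains V ℤ)
    (hind : LinearIndependent ℤ f) (hspan : Submodule.span ℤ (Set.range f) = M) :
    IsBasisOf (Set.range f) M := ⟨hind.linearIndepOn_id, hspan⟩

theorem isBasisOf_paths (s : Set (List V)) :
    IsBasisOf (Set.range fun l : s => path ℤ (l : List V)) (Finsupp.supported ℤ ℤ s) := by
  refine isBasisOf_range _ ?_ ?_
  · exact (Finsupp.linearIndependent_single_one ℤ (List V)).comp _ Subtype.val_injective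
  · rw [Finsupp.supported_eq_span_single]
    congr 1
    ext x
    simp [path]

theorem exists_isBasisOf_Omega_zero :
    ∃ B ⊆ inductiveElements G ℤ .upper 0, IsBasisOf B (Omega G ℤ (0 : ℕ)) := by
  refine ⟨_, ?_, ?_, (isBasisOf_paths _).2.trans (le_antisymm ?_ (Omega_le_allowed _))⟩
  · rintro _ ⟨⟨l, hl⟩, rfl⟩
    obtain ⟨a, rfl⟩ := mem_allowed_zero.1 hl
    exact ⟨a, .inl rfl⟩
  · exact (isBasisOf_paths _).1
  · intro x hx
    refine mapsTo_of_mem_supported (f := LinearMap.id) (fun l hl => ?_) hx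
    obtain ⟨a, rfl⟩ := mem_allowed_zero.1 hl
    exact path_one_mem_Omega a

theorem exists_isBasisOf_Omega_one :
    ∃ B ⊆ inductiveElements G ℤ .upper 1, IsBasisOf B (Omega G ℤ (1 : ℕ)) := by
  refine ⟨_, ?_, ?_, (isBasisOf_paths _).2.trans (le_antisymm ?_ (Omega_le_allowed _))⟩
  · rintro _ ⟨⟨l, hl⟩, rfl⟩
    obtain ⟨a, b, rfl, h⟩ := mem_allowed_one.1 hl
    exact path_two_mem_inductiveElements h
  · exact (isBasisOf_paths _).1
  · intro x hx
    refine mapsTo_of_mem_supported (f := LinearMap.id) (fun l hl => ?_) hx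
    obtain ⟨a, b, rfl, h⟩ := mem_allowed_one.1 hl
    exact path_two_mem_Omega h

/-! ### Two-dimensional elements -/

/-- Replaces the middle vertex of each path `a, b, c` whose ends differ and are not joined by
the chosen vertex `β a c`, and drops all other paths. -/
noncomputable def recenter (G : Digraph V) (β : V → V → V) : Chains V ℤ →ₗ[ℤ] Chains V ℤ :=
  Finsupp.linearCombination ℤ fun l => match l with
    | [a, _, c] => if IsBlocked G .upper c a then path ℤ [a, β a c, c] else 0
    | _ => 0

theorem recenter_path (β : V → V → V) (a b c : V) : recenter G β (path ℤ [a, b, c]) =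
    if IsBlocked G .upper c a then path ℤ [a, β a c, c] else 0 := by
  simp [recenter, path]

/-- The triangle, double edge or square that corresponds to a path with three vertices. -/
noncomputable def cell (G : Digraph V) (β : V → V → V) (l : List V) : Chains V ℤ :=
  path ℤ l - recenter G β (path ℤ l)

/-- The allowed `2`-paths with nonzero cell. -/
def cellPaths (G : Digraph V) (β : V → V → V) : Set (List V) :=
  {l | ∃ a b c, l = [a, b, c] ∧ G.Adj a b ∧ G.Adj b c ∧ (IsBlocked G .upper c a → b ≠ β a c)}

theorem cell_of_not_blocked (β : V → V → V) {a b c : V} (h : ¬ IsBlocked G .upper c a) :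
    cell G β [a, b, c] = path ℤ [a, b, c] := by
  rw [cell, recenter_path, if_neg h, sub_zero]

theorem cell_of_blocked (β : V → V → V) {a b c : V} (h : IsBlocked G .upper c a) :
    cell G β [a, b, c] = path ℤ [a, b, c] - path ℤ [a, β a c, c] := by
  rw [cell, recenter_path, if_pos h]

/-- The coefficient matrix of the cells at their own indexing paths is the identity, because
`cellPaths` omits the chosen paths aβc of blocked pairs, the only other paths that occur in cells.
Independence follows. -/
theorem cell_apply {β : V → V → V} {l l' : List V} (hl : l ∈ cellPaths G β)
    (hl' : l' ∈ cellPaths G β) : cell G β l' l = if l' = l then 1 else 0 := by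
  obtain ⟨a, b, c, rfl, -, -, h⟩ := hl
  obtain ⟨a', b', c', rfl, -, -, h'⟩ := hl'
  by_cases hb : IsBlocked G .upper c' a'
  · have hne : [a', β a' c', c'] ≠ [a, b, c] := by
      intro e
      simp only [List.cons.injEq, and_true] at e
      obtain ⟨rfl, h1, rfl⟩ := e
      exact h hb h1.symm
    rw [cell_of_blocked β hb, Finsupp.sub_apply, path, path, Finsupp.single_apply,
      Finsupp.single_apply, if_neg hne, sub_zero]
  · rw [cell_of_not_blocked β hb, path, Finsupp.single_apply]

theorem linearIndependent_cell (β : V → V → V) :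
    LinearIndependent ℤ fun l : cellPaths G β => cell G β l := by
  rw [linearIndependent_iff']
  intro S g hg i hi
  have := DFunLike.congr_fun hg (i : List V)
  simpa [Finsupp.finsetSum_apply, cell_apply i.2 (Subtype.property _), Subtype.ext_iff.symm, hi]
    using this

variable {β : V → V → V}

/-- In a square the two copies of the forbidden face ac cancel; if a is not blocked for c, then ac
is an edge or a = c. -/
theorem cell_mem_Omega
    (hβ : ∀ a b c, G.Adj a b → G.Adj b c → G.Adj a (β a c) ∧ G.Adj (β a c) c)
    {a b c : V} (hab : G.Adj a b) (hbc : G.Adj b c) :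
    cell G β [a, b, c] ∈ Omega G ℤ 2 := by
  obtain ⟨h1, h2⟩ := hβ a b c hab hbc
  have hall : ∀ {x y : V}, G.Adj x y → path ℤ [x, y] ∈ allowed G ℤ 1 ⊔ irregular V ℤ 1 :=
    fun h => Submodule.mem_sup_left (path_mem_allowed (by simp) (by simp) (by simpa using h))
  by_cases hb : IsBlocked G .upper c a
  · rw [cell_of_blocked β hb]
    refine ⟨sub_mem (path_mem_allowed (by simp) (by simp) (by simp [hab, hbc]))
      (path_mem_allowed (by simp) (by simp) (by simp [h1, h2])), ?_⟩
    rw [SetLike.mem_coe, Submodule.mem_comap, map_sub, boundary_path_three, boundary_path_three]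
    have : path ℤ [b, c] - path ℤ [a, c] + path ℤ [a, b] -
        (path ℤ [β a c, c] - path ℤ [a, c] + path ℤ [a, β a c]) =
        (path ℤ [b, c] + path ℤ [a, b]) - (path ℤ [β a c, c] + path ℤ [a, β a c]) := by abel
    rw [this]
    exact sub_mem (add_mem (hall hbc) (hall hab)) (add_mem (hall h2) (hall h1))
  · rw [cell_of_not_blocked β hb]
    refine ⟨path_mem_allowed (by simp) (by simp) (by simp [hab, hbc]), ?_⟩
    rw [SetLike.mem_coe, Submodule.mem_comap, boundary_path_three]
    refine add_mem (sub_mem (hall hbc) ?_) (hall hab)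
    by_cases hac : G.Adj a c
    · exact hall hac
    · have : a = c := by
        by_contra h
        exact hb ⟨hac, h⟩
      exact Submodule.mem_sup_right (path_mem_irregular (by simp) (by simp [this]))

theorem cell_mem_inductiveElements
    (hβ : ∀ a b c, G.Adj a b → G.Adj b c → G.Adj a (β a c) ∧ G.Adj (β a c) c)
    {l : List V} (hl : l ∈ cellPaths G β) :
    cell G β l ∈ inductiveElements G ℤ .upper 2 := by
  obtain ⟨a, b, c, rfl, hab, hbc, hne⟩ := hl
  obtain ⟨h1, h2⟩ := hβ a b c hab hbc
  have hΩ := cell_mem_Omega hβ hab hbc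
  have he : ∀ {b : V}, G.Adj a b → G.Adj b c →
      extend G ℤ .upper c (path ℤ [a, b]) = path ℤ [a, b, c] :=
    fun h h' => extend_path_of_isChain (s := .upper) (by simp [Side.add, h, h'])
  have hface : ∀ (b u : V), face ℤ .upper u (path ℤ [a, b]) = 0 ∨
      ∃ l, path ℤ l ∈ inductiveElements G ℤ .upper 0 ∧ path ℤ l ∈ Omega G ℤ 0 ∧
      (face ℤ .upper u (path ℤ [a, b]) = path ℤ l ∨ face ℤ .upper u (path ℤ [a, b]) = -path ℤ l) := by
    intro b u
    rw [face_upper_path_two]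
    split_ifs with h
    · exact .inr ⟨[a], ⟨a, .inl rfl⟩, path_one_mem_Omega a, .inl rfl⟩
    · exact .inl rfl
  have hend : ∀ b, path ℤ [a, b] ∈ Finsupp.supported ℤ ℤ {l | Side.upper.endpoint l = some b} :=
    fun b => Finsupp.single_mem_supported ℤ 1 (by simp [Side.endpoint])
  by_cases hb : IsBlocked G .upper c a
  · rw [cell_of_blocked β hb] at hΩ ⊢
    specialize hne hb
    -- The square is the extension of the two edges ab and −aβ, whose faces at the blocked vertex a
    -- cancel each other.
    let x : Bool → Chains V ℤ := fun i => if i then path ℤ [a, b] else -path ℤ [a, β a c]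
    have hx : extend G ℤ .upper c (∑ i ∈ Finset.univ, x i) =
        path ℤ [a, b, c] - path ℤ [a, β a c, c] := by
      simp only [Fintype.sum_bool, x, if_true, Bool.false_eq_true, if_false]
      rw [map_add, map_neg, he hab hbc, he h1 h2, sub_eq_add_neg]
    have hxneg : x true ≠ -x false := by
      simp only [x, if_true, Bool.false_eq_true, if_false, neg_neg]
      intro h
      simpa [hne] using path_injective h
    have hxa : ∀ i, face ℤ .upper a (x i) ≠ 0 := by
      rintro (_ | _) <;> simp [x, face_upper_path_two, path_ne_zero]
    have := isInductive_of_irreducible (n := 2) (s := .upper) (G := G) (v := c)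
      (E₁ := inductiveElements G ℤ .upper 1) (E₂ := inductiveElements G ℤ .upper 0)
      (Finset.univ : Finset Bool) (x := x) ?_ ?_ ?_ ?_ ?_ ?_ ?_ (by rw [hx]; exact hΩ) ?_
    · rw [hx] at this
      exact this
    · rintro (_ | _) -
      · exact neg_mem (path_two_mem_Omega h1)
      · exact path_two_mem_Omega hab
    · rintro (_ | _) - (_ | _) - hij
      · exact absurd rfl hij
      · intro h
        exact hxneg (by rw [h, neg_neg])
      · exact hxneg
      · exact absurd rfl hij
    · rintro (_ | _) -
      · right
        simpa [x] using path_two_mem_inductiveElements h1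
      · exact .inl (path_two_mem_inductiveElements hab)
    · rintro (_ | _) - u
      · have := hface (β a c) u
        simp only [x, Bool.false_eq_true, if_false, map_neg, neg_eq_zero, neg_inj]
        refine this.imp id fun ⟨l, h, h', h''⟩ => ⟨l, h, h', ?_⟩
        rw [neg_eq_iff_eq_neg]
        exact h''.symm
      · exact hface b u
    · rintro (_ | _) - w hw
      · rwa [endSet_subset_of_mem_supported (neg_mem (hend (β a c))) hw]
      · rwa [endSet_subset_of_mem_supported (hend b) hw]
    · intro u _
      simp [x, face_upper_path_two]
    -- A proper nonempty subfamily is a single edge, whose face at a is nonzero.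
    · intro S _ hS hSsum
      rw [Finset.eq_univ_iff_forall]
      by_contra hcon
      obtain ⟨i, hi⟩ := hS
      have hSi : S = {i} := by
        push Not at hcon
        obtain ⟨j, hj⟩ := hcon
        ext k
        rw [Finset.mem_singleton]
        constructor
        · intro hk
          by_contra hki
          have hij : i ≠ j := fun h => hj (h ▸ hi)
          have hkj : k ≠ j := fun h => hj (h ▸ hk)
          cases i <;> cases j <;> cases k <;> contradiction
        · rintro rfl; exact hi
      have := hSsum a hb
      rw [hSi, Finset.sum_singleton] at this
      exact hxa i this
    · refine endSet_extend ?_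
      rw [hx, sub_ne_zero]
      intro h
      simpa [hne] using path_injective h
  · rw [cell_of_not_blocked β hb] at hΩ ⊢
    have := isInductive_extend (G := G) (s := .upper) (n := 2) (v := c) (c := b)
      (x := path ℤ [a, b]) (E₁ := inductiveElements G ℤ .upper 1)
      (E₂ := inductiveElements G ℤ .upper 0) (path_two_mem_Omega hab)
      (path_two_mem_inductiveElements hab) (hface b) (hend b) hbc (fun u hu => by
        rw [face_upper_path_two, if_neg]
        rintro rfl
        exact hb hu) (by rw [he hab hbc]; exact hΩ) (by rw [he hab hbc]; exact path_ne_zero _)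
    rw [he hab hbc] at this
    exact this

/-- Summing the definition of `cell` gives x − `recenter G β x` on the right, so the obstruction to
writing x in cells is exactly the recentred chain. -/
theorem eq_sum_cell {x : Chains V ℤ} (hx : recenter G β x = 0) :
    x = ∑ l ∈ x.support, x l • cell G β l := by
  have h1 : x = ∑ l ∈ x.support, x l • path ℤ l := by
    conv_lhs => rw [← Finsupp.sum_single x]
    simp [Finsupp.sum, path]
  simp only [cell, smul_sub, Finset.sum_sub_distrib]
  have h2 : ∑ l ∈ x.support, x l • recenter G β (path ℤ l) = 0 := by
    rw [← hx]
    conv_rhs => rw [h1]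
    rw [map_sum]
    exact Finset.sum_congr rfl fun l _ => (map_smul _ _ _).symm
  rw [h2, sub_zero]
  exact h1

theorem eq_sum_cell_filter {x : Chains V ℤ} (hx : recenter G β x = 0)
    (hx' : x ∈ allowed G ℤ 2) :
    x = ∑ l ∈ x.support.filter (· ∈ cellPaths G β), x l • cell G β l := by
  conv_lhs => rw [eq_sum_cell hx]
  rw [Finset.sum_filter]
  refine Finset.sum_congr rfl fun l hl => ?_
  split_ifs with h
  · rfl
  · obtain ⟨a, b, c, rfl, hab, hbc⟩ := mem_allowed_two.1 (hx' hl)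
    have : IsBlocked G .upper c a ∧ b = β a c := by
      by_contra hcon
      exact h ⟨a, b, c, rfl, hab, hbc, fun h' h'' => hcon ⟨h', h''⟩⟩
    rw [cell_of_blocked β this.1, ← this.2, sub_self, smul_zero]

/-- For blocked pairs, recentring adds up the coefficients of all paths from a to c, which is minus
the coefficient of ac in the boundary. That pair is neither allowed nor irregular. -/
theorem recenter_eq_zero {x : Chains V ℤ} (hx : x ∈ Omega G ℤ 2) : recenter G β x = 0 := by
  let J : Chains V ℤ →ₗ[ℤ] Chains V ℤ := Finsupp.linearCombination ℤ fun l => match l with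
    | [a, c] => if IsBlocked G .upper c a then path ℤ [a, β a c, c] else 0
    | _ => 0
  have hJ : ∀ a c, J (path ℤ [a, c]) =
      if IsBlocked G .upper c a then path ℤ [a, β a c, c] else 0 := by
    intro a c; simp [J, path]
  have h1 : recenter G β x = -(J (boundary V ℤ x)) := by
    refine linearMap_eq_of_mem_supported (f := recenter G β) (g := -(J ∘ₗ boundary V ℤ))
      (fun l hl => ?_) hx.1
    obtain ⟨a, b, c, rfl, hab, hbc⟩ := mem_allowed_two.1 hl
    have h1 : ¬ IsBlocked G .upper c b := fun h => h.1 hbc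
    have h2 : ¬ IsBlocked G .upper b a := fun h => h.1 hab
    simp [boundary_path_three, hJ, recenter_path, h1, h2]
  have h2 : J (boundary V ℤ x) = 0 := by
    have : allowed G ℤ (2 - 1) ⊔ irregular V ℤ (2 - 1) ≤ LinearMap.ker J := by
      refine sup_le ?_ ?_
      · intro z hz
        refine mapsTo_of_mem_supported (f := J) (N := ⊥) (fun l hl => ?_) hz
        obtain ⟨a, b, rfl, h⟩ := mem_allowed_one.1 hl
        rw [Submodule.mem_bot, hJ, if_neg fun h' => h'.1 h]
      · intro z hz
        refine mapsTo_of_mem_supported (f := J) (N := ⊥) (fun l hl => ?_) hz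
        obtain ⟨hlen, hl⟩ := hl
        obtain ⟨a, b, rfl⟩ := List.length_eq_two.1 (by omega : l.length = 2)
        rw [Submodule.mem_bot, hJ, if_neg fun h' => hl (by simpa using h'.2)]
    exact this hx.2
  rw [h1, h2, neg_zero]

theorem span_cell
    (hβ : ∀ a b c, G.Adj a b → G.Adj b c → G.Adj a (β a c) ∧ G.Adj (β a c) c) :
    Submodule.span ℤ (Set.range fun l : cellPaths G β => cell G β l) =
    Omega G ℤ 2 := by
  apply le_antisymm
  · rw [Submodule.span_le]
    rintro _ ⟨⟨l, a, b, c, rfl, hab, hbc, -⟩, rfl⟩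
    exact cell_mem_Omega hβ hab hbc
  · intro x hx
    rw [eq_sum_cell_filter (recenter_eq_zero (β := β) hx) hx.1]
    exact Submodule.sum_mem _ fun l hl => Submodule.smul_mem _ _
      (Submodule.subset_span ⟨⟨l, (Finset.mem_filter.1 hl).2⟩, rfl⟩)

theorem exists_middle (G : Digraph V) : ∃ β : V → V → V,
    ∀ a b c, G.Adj a b → G.Adj b c → G.Adj a (β a c) ∧ G.Adj (β a c) c := by
  have : ∀ a c, ∃ b', ∀ b, G.Adj a b → G.Adj b c → G.Adj a b' ∧ G.Adj b' c := by
    intro a c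
    by_cases h : ∃ b, G.Adj a b ∧ G.Adj b c
    · obtain ⟨b, hb⟩ := h
      exact ⟨b, fun _ _ _ => hb⟩
    · exact ⟨a, fun b h1 h2 => absurd ⟨b, h1, h2⟩ h⟩
  choose β hβ using this
  exact ⟨β, fun a b c => hβ a c b⟩

theorem exists_isBasisOf_Omega_two :
    ∃ B ⊆ inductiveElements G ℤ .upper 2, IsBasisOf B (Omega G ℤ (2 : ℕ)) := by
  obtain ⟨β, hβ⟩ := exists_middle G
  refine ⟨_, ?_, isBasisOf_range _ (linearIndependent_cell (G := G) β) (span_cell hβ)⟩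
  rintro _ ⟨l, rfl⟩
  exact cell_mem_inductiveElements hβ l.2

end Upper

/-! ### Upper inductive elements in dimension three -/

section UpperThree

open scoped Classical

variable {V : Type*} {G : Digraph V} {β : V → V → V}

/-- The two paths of a nonzero square have different middle vertices, so at most one of them
contributes to a given face. -/
theorem face_cell_eq {l : List V} (hl : l ∈ cellPaths G β) (u : V) :
    face ℤ .upper u (cell G β l) = 0 ∨ ∃ a b, face ℤ .upper u (cell G β l) = path ℤ [a, b] ∨
      face ℤ .upper u (cell G β l) = -path ℤ [a, b] := by
  obtain ⟨a, b, c, rfl, hab, hbc, hne⟩ := hl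
  by_cases hb : IsBlocked G .upper c a
  · rw [cell_of_blocked β hb, map_sub, face_upper_path_three, face_upper_path_three]
    by_cases h1 : b = u
    · have h2 : β a c ≠ u := fun h => hne hb (h1.trans h.symm)
      rw [if_pos h1, if_neg h2, sub_zero]
      exact .inr ⟨a, b, .inl rfl⟩
    · rw [if_neg h1, zero_sub]
      split_ifs
      · exact .inr ⟨a, β a c, .inr rfl⟩
      · simp
  · rw [cell_of_not_blocked β hb, face_upper_path_three]
    split_ifs
    · exact .inr ⟨a, b, .inl rfl⟩
    · exact .inl rfl

theorem face_mem_allowed {x : Chains V ℤ} (hx : x ∈ allowed G ℤ 2) (u : V) :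
    face ℤ .upper u x ∈ allowed G ℤ 1 := by
  refine mapsTo_of_mem_supported (f := face ℤ .upper u) (fun l hl => ?_) hx
  obtain ⟨a, b, c, rfl, hab, hbc⟩ := mem_allowed_two.1 hl
  rw [face_upper_path_three]
  split_ifs
  · exact path_mem_allowed (by simp) (by simp) (by simpa using hab)
  · exact zero_mem _

theorem cell_mem_supported {l : List V} {v : V} (hl : l ∈ cellPaths G β)
    (hv : l.getLast? = some v) :
    cell G β l ∈ Finsupp.supported ℤ ℤ {l | Side.upper.endpoint l = some v} := by
  obtain ⟨a, b, c, rfl, -, -, -⟩ := hl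
  obtain rfl : c = v := by simpa using hv
  have h : ∀ b, path ℤ [a, b, c] ∈
      Finsupp.supported ℤ ℤ {l | Side.upper.endpoint l = some c} := fun b =>
    Finsupp.single_mem_supported ℤ 1 (by simp [Side.endpoint])
  by_cases hb : IsBlocked G .upper c a
  · rw [cell_of_blocked β hb]
    exact sub_mem (h _) (h _)
  · rw [cell_of_not_blocked β hb]
    exact h _

/-- The component of a chain of the paths with head `v`, with `v` removed. -/
noncomputable def headPart (v : V) : Chains V ℤ →ₗ[ℤ] Chains V ℤ :=
  Finsupp.linearCombination ℤ fun l =>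
    if l.getLast? = some v then path ℤ l.dropLast else 0

theorem headPart_path (v : V) (l : List V) :
    headPart v (path ℤ l) = if l.getLast? = some v then path ℤ l.dropLast else 0 := by
  simp [headPart, path]

theorem headPart_mem_supported {x : Chains V ℤ} (hx : x ∈ allowed G ℤ (3 : ℕ)) (v : V) :
    headPart v x ∈ Finsupp.supported ℤ ℤ
      {l | ∃ a b c, l = [a, b, c] ∧ G.Adj a b ∧ G.Adj b c ∧ G.Adj c v} := by
  refine mapsTo_of_mem_supported (f := headPart v) (fun l hl => ?_) hx
  obtain ⟨a, b, c, d, rfl, hab, hbc, hcd⟩ := mem_allowed_three.1 hl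
  rw [headPart_path]
  split_ifs with h
  · obtain rfl : d = v := by simpa using h
    exact Finsupp.single_mem_supported ℤ 1 ⟨a, b, c, rfl, hab, hbc, hcd⟩
  · exact zero_mem _

theorem eq_sum_extend_headPart {x : Chains V ℤ} (hx : x ∈ allowed G ℤ (3 : ℕ)) :
    ∃ S : Finset V, x = ∑ v ∈ S, extend G ℤ .upper v (headPart v x) := by
  let S : Finset V := x.support.biUnion fun l => l.toFinset
  refine ⟨S, ?_⟩
  have := linearMap_eq_of_mem_supported (f := LinearMap.id)
    (g := ∑ v ∈ S, extend G ℤ .upper v ∘ₗ headPart v) (s := x.support) (fun l hl => ?_)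
    (x := x) (by rw [Finsupp.mem_supported])
  · simpa using this
  · obtain ⟨a, b, c, d, rfl, hab, hbc, hcd⟩ := mem_allowed_three.1 (hx hl)
    have hd : d ∈ S := Finset.mem_biUnion.2 ⟨_, hl, by simp⟩
    rw [LinearMap.sum_apply, Finset.sum_eq_single d]
    · rw [LinearMap.comp_apply, headPart_path, if_pos (by simp)]
      exact (extend_path_of_isChain (s := .upper) (l := [a, b, c])
        (by simp [Side.add, hab, hbc, hcd])).symm
    · intro v _ hv
      rw [LinearMap.comp_apply, headPart_path, if_neg (by simpa using hv.symm), map_zero]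
    · exact fun h => absurd hd h

/-- The faces acv with a blocked for c arise only by deleting the second vertex of a path abcv,
since all other faces begin with an edge. They are regular and not allowed, so their coefficients in
the boundary vanish. -/
theorem recenter_headPart_eq_zero (hG : ∀ v, ¬ G.Adj v v) {x : Chains V ℤ}
    (hx : x ∈ Omega G ℤ (3 : ℕ)) (v : V) : recenter G β (headPart v x) = 0 := by
  -- The condition `G.Adj c v` holds for all relevant faces; as there are no loops it gives c ≠ v,
  -- so that J kills irregular paths.
  let J : Chains V ℤ →ₗ[ℤ] Chains V ℤ := Finsupp.linearCombination ℤ fun l => match l with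
    | [a, c, d] => if d = v ∧ G.Adj c v ∧ IsBlocked G .upper c a then path ℤ [a, β a c, c] else 0
    | _ => 0
  have hJ : ∀ a c d, J (path ℤ [a, c, d]) =
      if d = v ∧ G.Adj c v ∧ IsBlocked G .upper c a then path ℤ [a, β a c, c] else 0 := by
    intro a c d; simp [J, path]
  have hJ0 : ∀ a c d, G.Adj a c → J (path ℤ [a, c, d]) = 0 := fun a c d h => by
    rw [hJ, if_neg fun h' => h'.2.2.1 h]
  have h1 : recenter G β (headPart v x) = -(J (boundary V ℤ x)) := by
    refine linearMap_eq_of_mem_supported (f := recenter G β ∘ₗ headPart v)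
      (g := -(J ∘ₗ boundary V ℤ)) (fun l hl => ?_) hx.1
    obtain ⟨a, b, c, d, rfl, hab, hbc, hcd⟩ := mem_allowed_three.1 hl
    rw [LinearMap.comp_apply, LinearMap.neg_apply, LinearMap.comp_apply, boundary_path_four,
      map_sub, map_add, map_sub, hJ0 _ _ _ hbc, hJ0 _ _ _ hab, hJ0 _ _ _ hab, hJ, headPart_path]
    by_cases hd : d = v
    · subst hd
      simp [recenter_path, hcd]
    · simp [hd]
  have h2 : J (boundary V ℤ x) = 0 := by
    have : allowed G ℤ ((3 : ℕ) - 1) ⊔ irregular V ℤ ((3 : ℕ) - 1) ≤ LinearMap.ker J := by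
      refine sup_le ?_ ?_
      · intro z hz
        refine mapsTo_of_mem_supported (f := J) (N := ⊥) (fun l hl => ?_) hz
        obtain ⟨a, b, c, rfl, h, -⟩ := mem_allowed_two.1 hl
        rw [Submodule.mem_bot, hJ0 _ _ _ h]
      · intro z hz
        refine mapsTo_of_mem_supported (f := J) (N := ⊥) (fun l hl => ?_) hz
        obtain ⟨hlen, hl⟩ := hl
        obtain ⟨a, b, c, rfl⟩ := List.length_eq_three.1 (by omega : l.length = 3)
        rw [Submodule.mem_bot, hJ, if_neg]
        rintro ⟨rfl, hbc, -, hne⟩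
        refine hl ?_
        simp only [List.isChain_cons_cons, ne_eq, List.isChain_singleton, and_true]
        exact ⟨hne, fun h => hG c (h ▸ hbc)⟩
    exact this hx.2
  rw [h1, h2, neg_zero]

/-- Here the third vertex is deleted: faces auv with u blocked for v arise in no other way, since
all other faces end with an edge. -/
theorem face_headPart_eq_zero (hG : ∀ v, ¬ G.Adj v v) {x : Chains V ℤ}
    (hx : x ∈ Omega G ℤ (3 : ℕ)) {u v : V} (hu : IsBlocked G .upper v u) :
    face ℤ .upper u (headPart v x) = 0 := by
  let J : Chains V ℤ →ₗ[ℤ] Chains V ℤ := Finsupp.linearCombination ℤ fun l => match l with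
    | [a, b, d] => if d = v ∧ b = u ∧ G.Adj a u then path ℤ [a, u] else 0
    | _ => 0
  have hJ : ∀ a b d, J (path ℤ [a, b, d]) =
      if d = v ∧ b = u ∧ G.Adj a u then path ℤ [a, u] else 0 := by
    intro a b d; simp [J, path]
  have hJ0 : ∀ a b d, G.Adj b d → J (path ℤ [a, b, d]) = 0 := fun a b d h => by
    rw [hJ, if_neg]
    rintro ⟨rfl, rfl, -⟩
    exact hu.1 h
  have h1 : face ℤ .upper u (headPart v x) = J (boundary V ℤ x) := by
    refine linearMap_eq_of_mem_supported (f := face ℤ .upper u ∘ₗ headPart v)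
      (g := J ∘ₗ boundary V ℤ) (fun l hl => ?_) hx.1
    obtain ⟨a, b, c, d, rfl, hab, hbc, hcd⟩ := mem_allowed_three.1 hl
    rw [LinearMap.comp_apply, LinearMap.comp_apply, boundary_path_four,
      map_sub, map_add, map_sub, hJ0 _ _ _ hcd, hJ0 _ _ _ hcd, hJ0 _ _ _ hbc, hJ, headPart_path]
    by_cases hd : d = v
    · subst hd
      by_cases hb : b = u
      · subst hb
        simp [face_upper_path_three, hab]
      · simp [face_upper_path_three, hb]
    · simp [hd]
  have h2 : J (boundary V ℤ x) = 0 := by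
    have : allowed G ℤ ((3 : ℕ) - 1) ⊔ irregular V ℤ ((3 : ℕ) - 1) ≤ LinearMap.ker J := by
      refine sup_le ?_ ?_
      · intro z hz
        refine mapsTo_of_mem_supported (f := J) (N := ⊥) (fun l hl => ?_) hz
        obtain ⟨a, b, c, rfl, -, h⟩ := mem_allowed_two.1 hl
        rw [Submodule.mem_bot, hJ0 _ _ _ h]
      · intro z hz
        refine mapsTo_of_mem_supported (f := J) (N := ⊥) (fun l hl => ?_) hz
        obtain ⟨hlen, hl⟩ := hl
        obtain ⟨a, b, c, rfl⟩ := List.length_eq_three.1 (by omega : l.length = 3)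
        rw [Submodule.mem_bot, hJ, if_neg]
        rintro ⟨rfl, rfl, hab⟩
        refine hl ?_
        simp only [List.isChain_cons_cons, ne_eq, List.isChain_singleton, and_true]
        exact ⟨fun h => hG b (h ▸ hab), hu.2⟩
    exact this hx.2
  rw [h1, h2]

/-- Extensions of sums of cells lie in `Ω_3` if the blocked faces cancel. -/
theorem extend_mem_Omega_three
    (hβ : ∀ a b c, G.Adj a b → G.Adj b c → G.Adj a (β a c) ∧ G.Adj (β a c) c) {v : V}
    {z : Chains V ℤ} (hz : z ∈ Submodule.span ℤ (cell G β ''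
      {l | l ∈ cellPaths G β ∧ ∃ c, l.getLast? = some c ∧ G.Adj c v}))
    (hface : ∀ u, IsBlocked G .upper v u → face ℤ .upper u z = 0) :
    extend G ℤ .upper v z ∈ Omega G ℤ (3 : ℕ) := by
  have hcase : ∀ l ∈ {l | l ∈ cellPaths G β ∧ ∃ c, l.getLast? = some c ∧ G.Adj c v},
      ∃ a b c, l = [a, b, c] ∧ G.Adj a b ∧ G.Adj b c ∧ G.Adj c v := by
    rintro _ ⟨⟨a, b, c, rfl, hab, hbc, -⟩, c', hc, hcv⟩
    obtain rfl : c = c' := by simpa using hc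
    exact ⟨a, b, c, rfl, hab, hbc, hcv⟩
  have hsupp : z ∈ Finsupp.supported ℤ ℤ
      {l | ∃ a b c, l = [a, b, c] ∧ G.Adj a b ∧ G.Adj b c ∧ G.Adj c v} := by
    refine (Submodule.span_le.2 ?_) hz
    rintro _ ⟨l, hl, rfl⟩
    obtain ⟨a, b, c, rfl, hab, hbc, hcv⟩ := hcase l hl
    obtain ⟨h1, h2⟩ := hβ a b c hab hbc
    have h : ∀ {b}, G.Adj a b → G.Adj b c → path ℤ [a, b, c] ∈ Finsupp.supported ℤ ℤ
        {l | ∃ a b c, l = [a, b, c] ∧ G.Adj a b ∧ G.Adj b c ∧ G.Adj c v} := fun h h' =>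
      Finsupp.single_mem_supported ℤ 1 ⟨_, _, _, rfl, h, h', hcv⟩
    by_cases hb : IsBlocked G .upper c a
    · rw [cell_of_blocked β hb]
      exact sub_mem (h hab hbc) (h h1 h2)
    · rw [cell_of_not_blocked β hb]
      exact h hab hbc
  have hext : ∀ {a b c : V}, G.Adj a b → G.Adj b c → G.Adj c v →
      extend G ℤ .upper v (path ℤ [a, b, c]) = path ℤ [a, b, c, v] := fun h h' h'' =>
    extend_path_of_isChain (s := .upper) (by simp [Side.add, h, h', h''])
  let N : Submodule ℤ (Chains V ℤ) := allowed G ℤ (2 : ℕ) ⊔ irregular V ℤ (2 : ℕ)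
  have hall : ∀ {a b c : V}, G.Adj a b → G.Adj b c → path ℤ [a, b, c] ∈ N := fun h h' =>
    Submodule.mem_sup_left (path_mem_allowed (by simp) (by simp) (by simp [h, h']))
  have hirr : ∀ {a b c : V}, a = b ∨ b = c → path ℤ [a, b, c] ∈ N := fun h =>
    Submodule.mem_sup_right (path_mem_irregular (by simp) (by simp; tauto))
  refine ⟨?_, ?_⟩
  · refine mapsTo_of_mem_supported (f := extend G ℤ .upper v) ?_ hsupp
    rintro _ ⟨a, b, c, rfl, hab, hbc, hcv⟩
    rw [hext hab hbc hcv]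
    exact path_mem_allowed (by simp) (by simp) (by simp [hab, hbc, hcv])
  · let A : Chains V ℤ →ₗ[ℤ] Chains V ℤ := Finsupp.linearCombination ℤ fun l => match l with
      | [a, _, c] => path ℤ [a, c, v]
      | _ => 0
    let B : Chains V ℤ →ₗ[ℤ] Chains V ℤ := Finsupp.linearCombination ℤ fun l => path ℤ (l ++ [v])
    have hA : ∀ a b c, A (path ℤ [a, b, c]) = path ℤ [a, c, v] := by
      intro a b c; simp [A, path]
    have hB : ∀ l, B (path ℤ l) = path ℤ (l ++ [v]) := by
      intro l; simp [B, path]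
    have hAz : A z ∈ N := by
      have : Submodule.span ℤ (cell G β ''
          {l | l ∈ cellPaths G β ∧ ∃ c, l.getLast? = some c ∧ G.Adj c v}) ≤ N.comap A := by
        rw [Submodule.span_le]
        rintro _ ⟨l, hl, rfl⟩
        obtain ⟨a, b, c, rfl, hab, hbc, hcv⟩ := hcase l hl
        rw [SetLike.mem_coe, Submodule.mem_comap]
        by_cases hb : IsBlocked G .upper c a
        · rw [cell_of_blocked β hb, map_sub, hA, hA, sub_self]
          exact zero_mem _
        · rw [cell_of_not_blocked β hb, hA]
          by_cases hac : G.Adj a c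
          · exact hall hac hcv
          · refine hirr (.inl ?_)
            by_contra h
            exact hb ⟨hac, h⟩
      exact this hz
    let S : Finset V := z.support.biUnion fun l => l.toFinset
    have hBz : ∑ u ∈ S, B (face ℤ .upper u z) ∈ N := by
      refine Submodule.sum_mem _ fun u _ => ?_
      by_cases hu : IsBlocked G .upper v u
      · rw [hface u hu, map_zero]
        exact zero_mem _
      · refine mapsTo_of_mem_supported (f := B ∘ₗ face ℤ .upper u) ?_ hsupp
        rintro _ ⟨a, b, c, rfl, hab, hbc, hcv⟩
        rw [LinearMap.comp_apply, face_upper_path_three]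
        split_ifs with h
        · subst h
          rw [hB]
          by_cases hbv : G.Adj b v
          · exact hall hab hbv
          · refine hirr (.inr ?_)
            by_contra h
            exact hu ⟨hbv, h⟩
        · rw [map_zero]
          exact zero_mem _
    have hrest : boundary V ℤ (extend G ℤ .upper v z) + A z - ∑ u ∈ S, B (face ℤ .upper u z) ∈
        N := by
      have := mapsTo_of_mem_supported
        (f := boundary V ℤ ∘ₗ extend G ℤ .upper v + A - ∑ u ∈ S, B ∘ₗ face ℤ .upper u)
        (s := z.support) (N := N) (x := z) (fun l hl => ?_) (by rw [Finsupp.mem_supported])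
      · simpa using this
      · obtain ⟨a, b, c, rfl, hab, hbc, hcv⟩ := hsupp hl
        have hb : b ∈ S := Finset.mem_biUnion.2 ⟨_, hl, by simp⟩
        rw [LinearMap.sub_apply, LinearMap.add_apply, LinearMap.sum_apply,
          Finset.sum_eq_single b]
        · simp only [LinearMap.comp_apply]
          rw [face_upper_path_three, if_pos rfl, hB, hext hab hbc hcv, boundary_path_four, hA]
          have : path ℤ [b, c, v] - path ℤ [a, c, v] + path ℤ [a, b, v] - path ℤ [a, b, c] +
              path ℤ [a, c, v] - path ℤ ([a, b] ++ [v]) = path ℤ [b, c, v] - path ℤ [a, b, c] := by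
            simp only [List.cons_append, List.nil_append]
            abel
          rw [this]
          exact sub_mem (hall hbc hcv) (hall hab hbc)
        · intro u _ hu
          rw [LinearMap.comp_apply, face_upper_path_three, if_neg hu.symm, map_zero]
        · exact fun h => absurd hb h
    have := add_mem (sub_mem hrest hAz) hBz
    have h' : boundary V ℤ (extend G ℤ .upper v z) + A z - ∑ u ∈ S, B (face ℤ .upper u z) - A z +
        ∑ u ∈ S, B (face ℤ .upper u z) = boundary V ℤ (extend G ℤ .upper v z) := by abel
    rw [h'] at this
    exact this

theorem sign_smul_eq_or {a : ℤ} (ha : a ≠ 0) (x : Chains V ℤ) :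
    a.sign • x = x ∨ a.sign • x = -x := by
  rcases lt_or_gt_of_ne ha with h | h
  · right; rw [Int.sign_eq_neg_one_of_neg h, neg_one_zsmul]
  · left; rw [Int.sign_eq_one_of_pos h, one_zsmul]

theorem extend_headPart_mem_span (hG : ∀ v, ¬ G.Adj v v) {x : Chains V ℤ}
    (hx : x ∈ Omega G ℤ (3 : ℕ)) (v : V) :
    extend G ℤ .upper v (headPart v x) ∈
      Submodule.span ℤ (inductiveElements G ℤ .upper 3) := by
  obtain ⟨β, hβ⟩ := exists_middle G
  let y := headPart v x
  have hysupp := headPart_mem_supported hx.1 v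
  let T := y.support.filter (· ∈ cellPaths G β)
  have hTy : ∀ l ∈ T, y l ≠ 0 := fun l hl => Finsupp.mem_support_iff.1 (Finset.mem_filter.1 hl).1
  have hT : ∀ l ∈ T, l ∈ cellPaths G β ∧ ∃ c, l.getLast? = some c ∧ G.Adj c v := by
    intro l hl
    obtain ⟨h1, h2⟩ := Finset.mem_filter.1 hl
    obtain ⟨a, b, c, rfl, -, -, h⟩ := hysupp h1
    exact ⟨h2, c, by simp, h⟩
  have hy : y = ∑ l ∈ T, y l • cell G β l := by
    refine eq_sum_cell_filter (recenter_headPart_eq_zero hG hx v) ?_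
    intro l hl
    obtain ⟨a, b, c, rfl, hab, hbc, -⟩ := hysupp hl
    exact mem_allowed_two.2 ⟨a, b, c, rfl, hab, hbc⟩
  -- Each cell is repeated |y l| times with the sign of y l. All copies of a cell have the same
  -- sign, so no two members of the family are negatives of each other.
  let ι := Σ l : T, Fin (y l).natAbs
  let f : ι → Chains V ℤ := fun i => (y i.1).sign • cell G β i.1
  have hf : ∀ i : ι, f i = cell G β i.1 ∨ f i = -cell G β i.1 := fun i =>
    sign_smul_eq_or (hTy _ i.1.2) _
  have hsum : ∑ i, f i = y := by
    rw [Fintype.sum_sigma]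
    simp only [f, Finset.sum_const, Finset.card_univ, Fintype.card_fin]
    rw [Finset.sum_coe_sort T fun l => (y l).natAbs • (y l).sign • cell G β l]
    conv_rhs => rw [hy]
    refine Finset.sum_congr rfl fun l _ => ?_
    rw [← natCast_zsmul, smul_smul, mul_comm, Int.sign_mul_natAbs]
  have hcellΩ : ∀ l ∈ T, cell G β l ∈ Omega G ℤ 2 := by
    intro l hl
    obtain ⟨a, b, c, rfl, hab, hbc, -⟩ := (hT l hl).1
    exact cell_mem_Omega hβ hab hbc
  have key := extend_sum_mem_span (G := G) (s := .upper) (n := 3) (v := v) (x := f)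
    (E₁ := inductiveElements G ℤ .upper 2) (E₂ := inductiveElements G ℤ .upper 1)
    ?_ ?_ ?_ ?_ ?_ ?_ Finset.univ ?_
  · rw [hsum] at key
    exact key
  · intro i
    exact zsmul_mem (hcellΩ _ i.1.2) _
  · rintro ⟨l, k⟩ ⟨l', k'⟩ hne h
    have h' := DFunLike.congr_fun h (l : List V)
    simp only [f, Finsupp.smul_apply, Finsupp.neg_apply, smul_eq_mul,
      cell_apply (hT _ l.2).1 (hT _ l.2).1, cell_apply (hT _ l.2).1 (hT _ l'.2).1, if_true,
      mul_one] at h'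
    have hs := Int.sign_eq_zero_iff_zero (a := y l)
    have hl := hTy _ l.2
    split_ifs at h' with hll
    · rw [hll] at h'
      omega
    · omega
  · intro i
    rcases hf i with h | h <;> rw [h]
    · exact .inl (cell_mem_inductiveElements hβ (hT _ i.1.2).1)
    · right
      rw [neg_neg]
      exact cell_mem_inductiveElements hβ (hT _ i.1.2).1
  · intro i u
    have hall := face_mem_allowed (hcellΩ _ i.1.2).1 u
    have hmem : ∀ a b, path ℤ [a, b] ∈ allowed G ℤ 1 →
        path ℤ [a, b] ∈ inductiveElements G ℤ .upper 1 ∧ path ℤ [a, b] ∈ Omega G ℤ (3 - 1 - 1) := by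
      intro a b h
      have hab : G.Adj a b := by
        have := h (show [a, b] ∈ (path ℤ [a, b]).support by simp [path])
        simpa using this.2.2
      exact ⟨path_two_mem_inductiveElements hab, path_two_mem_Omega hab⟩
    rcases face_cell_eq (hT _ i.1.2).1 u with h0 | ⟨a, b, h0 | h0⟩
    · left
      rcases hf i with h | h <;> simp [h, h0]
    · right
      rw [h0] at hall
      refine ⟨[a, b], (hmem a b hall).1, (hmem a b hall).2, ?_⟩
      rcases hf i with h | h <;> simp [h, h0]
    · right
      rw [h0, neg_mem_iff] at hall
      refine ⟨[a, b], (hmem a b hall).1, (hmem a b hall).2, ?_⟩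
      rcases hf i with h | h <;> simp [h, h0]
  · intro i w hw
    obtain ⟨hl, c, hc, hcv⟩ := hT _ i.1.2
    have : f i ∈ Finsupp.supported ℤ ℤ {l | Side.upper.endpoint l = some c} :=
      Submodule.smul_mem _ _ (cell_mem_supported hl hc)
    rwa [endSet_subset_of_mem_supported this hw]
  · intro A hA
    refine extend_mem_Omega_three hβ (Submodule.sum_mem _ fun i _ => ?_) (fun u hu => ?_)
    · exact Submodule.smul_mem _ _ (Submodule.subset_span ⟨_, hT _ i.1.2, rfl⟩)
    · rw [map_sum]
      exact hA u hu
  · intro u hu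
    rw [← map_sum, hsum]
    exact face_headPart_eq_zero hG hx hu

theorem inductiveElements_subset_Omega {R : Type*} [CommRing R] (s : Side) (n : ℕ) :
    inductiveElements G R s (n + 2) ⊆ (Omega G R ((n : ℤ) + 2) : Set (Chains V R)) :=
  fun _ h => h.1

theorem span_inductiveElements_three_upper (hG : ∀ v, ¬ G.Adj v v) :
    Submodule.span ℤ (inductiveElements G ℤ .upper 3) = Omega G ℤ 3 := by
  apply le_antisymm
  · exact Submodule.span_le.2 (inductiveElements_subset_Omega .upper 1)
  · intro x hx
    obtain ⟨S, hS⟩ := eq_sum_extend_headPart (show x ∈ allowed G ℤ (3 : ℕ) from hx.1)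
    rw [hS]
    exact Submodule.sum_mem _ fun v _ => extend_headPart_mem_span hG hx v

end UpperThree

/-! ### Reversal of paths: from upper to lower -/

section Reversal

variable {V : Type*}

theorem face_path_of_eq {s : Side} {u : V} {l : List V} (h : s.endpoint (s.truncate l) = some u) :
    face ℤ s u (path ℤ l) = path ℤ (s.truncate l) := by
  simp only [face, path, Finsupp.linearCombination_single, one_smul]
  exact if_pos h

theorem face_path_of_ne {s : Side} {u : V} {l : List V} (h : s.endpoint (s.truncate l) ≠ some u) :
    face ℤ s u (path ℤ l) = 0 := by
  simp only [face, path, Finsupp.linearCombination_single, one_smul]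
  exact if_neg h

theorem extend_path_of_not_isChain {G : Digraph V} {s : Side} {v : V} {l : List V}
    (h : ¬ (s.add v l).IsChain G.Adj) : extend G ℤ s v (path ℤ l) = 0 := by
  simp only [extend, path, Finsupp.linearCombination_single, one_smul]
  exact if_neg h

/-- The digraph with all edges reversed. -/
def reverseDigraph (G : Digraph V) : Digraph V := ⟨fun a b => G.Adj b a⟩

/-- Reversal of paths. -/
noncomputable def reverseChains (V : Type*) : Chains V ℤ →ₗ[ℤ] Chains V ℤ :=
  Finsupp.lmapDomain ℤ ℤ List.reverse

theorem reverseChains_path (l : List V) : reverseChains V (path ℤ l) = path ℤ l.reverse := by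
  simp [reverseChains, path]

theorem linearMap_ext_path {M : Type*} [AddCommGroup M] {f g : Chains V ℤ →ₗ[ℤ] M}
    (h : ∀ l, f (path ℤ l) = g (path ℤ l)) : f = g :=
  LinearMap.ext fun _ => linearMap_eq_of_mem_supported (s := Set.univ) (fun l _ => h l) (by simp)

theorem reverseChains_reverseChains (x : Chains V ℤ) :
    reverseChains V (reverseChains V x) = x := by
  have : reverseChains V ∘ₗ reverseChains V = LinearMap.id :=
    linearMap_ext_path fun l => by simp [reverseChains_path]
  exact LinearMap.congr_fun this x

theorem reverseChains_apply (x : Chains V ℤ) (l : List V) :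
    reverseChains V x l = x l.reverse := by
  have := Finsupp.mapDomain_apply (List.reverse_injective (α := V)) x l.reverse
  rwa [List.reverse_reverse] at this

theorem eraseIdx_reverse (l : List V) {i : ℕ} (hi : i < l.length) :
    l.reverse.eraseIdx i = (l.eraseIdx (l.length - 1 - i)).reverse := by
  rw [List.eraseIdx_eq_take_drop_succ, List.eraseIdx_eq_take_drop_succ, List.reverse_append,
    List.take_reverse, List.drop_reverse]
  congr 3 <;> omega

/-- Reversal turns deletion at position i into deletion at position n − i, where n + 1 is the
length; the sign changes by (−1)^n, constant on n-chains, so Ω_n is preserved. -/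
theorem boundary_reverse_path (l : List V) :
    boundary V ℤ (path ℤ l.reverse) =
      (-1 : ℤ) ^ (l.length - 1) • reverseChains V (boundary V ℤ (path ℤ l)) := by
  rw [path, path, boundary_single, boundary_single, List.length_reverse]
  split_ifs with h
  · rw [map_sum, Finset.smul_sum, ← Finset.sum_range_reflect]
    refine Finset.sum_congr rfl fun i hi => ?_
    rw [Finset.mem_range] at hi
    rw [map_zsmul, smul_smul, eraseIdx_reverse l (by omega),
      show l.length - 1 - (l.length - 1 - i) = i by omega, ← pow_add]
    congr 1
    · obtain ⟨k, hk⟩ : ∃ k, l.length - 1 = i + k := ⟨l.length - 1 - i, by omega⟩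
      rw [hk, show i + k - i = k by omega, show i + k + i = k + 2 * i by ring, pow_add,
        pow_mul]
      simp
    · exact (reverseChains_path _).symm
  · simp

theorem reverseChains_mem_supported {s t : Set (List V)} (h : ∀ l ∈ s, l.reverse ∈ t)
    {x : Chains V ℤ} (hx : x ∈ Finsupp.supported ℤ ℤ s) :
    reverseChains V x ∈ Finsupp.supported ℤ ℤ t := by
  refine mapsTo_of_mem_supported (f := reverseChains V) (fun l hl => ?_) hx
  rw [reverseChains_path]
  exact Finsupp.single_mem_supported ℤ 1 (h l hl)

theorem reverseChains_mem_allowed {G : Digraph V} {n : ℤ} {x : Chains V ℤ}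
    (hx : x ∈ allowed (reverseDigraph G) ℤ n) : reverseChains V x ∈ allowed G ℤ n := by
  refine reverseChains_mem_supported ?_ hx
  rintro l ⟨h0, hlen, h⟩
  exact ⟨by simpa using h0, by simpa using hlen, List.isChain_reverse.2 h⟩

theorem reverseChains_mem_irregular {n : ℤ} {x : Chains V ℤ}
    (hx : x ∈ irregular V ℤ n) : reverseChains V x ∈ irregular V ℤ n := by
  refine reverseChains_mem_supported ?_ hx
  rintro l ⟨hlen, h⟩
  refine ⟨by simpa using hlen, fun h' => h ?_⟩
  rw [List.isChain_reverse] at h'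
  simpa only [ne_comm] using h'

theorem reverseChains_mem_Omega {G : Digraph V} {n : ℤ} {x : Chains V ℤ}
    (hx : x ∈ Omega (reverseDigraph G) ℤ n) : reverseChains V x ∈ Omega G ℤ n := by
  refine ⟨reverseChains_mem_allowed hx.1, ?_⟩
  have h : boundary V ℤ (reverseChains V x) =
      (-1 : ℤ) ^ n.toNat • reverseChains V (boundary V ℤ x) := by
    refine linearMap_eq_of_mem_supported (f := boundary V ℤ ∘ₗ reverseChains V)
      (g := (-1 : ℤ) ^ n.toNat • reverseChains V ∘ₗ boundary V ℤ) (fun l hl => ?_) hx.1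
    obtain ⟨-, hlen, -⟩ := hl
    rw [LinearMap.comp_apply, reverseChains_path, boundary_reverse_path,
      show l.length - 1 = n.toNat by omega]
    rfl
  rw [SetLike.mem_coe, Submodule.mem_comap, h]
  refine Submodule.smul_mem _ _ ?_
  obtain ⟨a, ha, b, hb, hab⟩ := Submodule.mem_sup.1 hx.2
  rw [← hab, map_add]
  exact Submodule.add_mem_sup (reverseChains_mem_allowed ha) (reverseChains_mem_irregular hb)

theorem isPathEmbedding_reverseChains (G : Digraph V) :
    IsPathEmbedding (reverseDigraph G) G .upper .lower (reverseChains V).toAddMonoidHom where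
  injective := Function.LeftInverse.injective (g := reverseChains V) reverseChains_reverseChains
  mem_omega _ _ h := reverseChains_mem_Omega h
  face_map u x := by
    have : face ℤ .lower u ∘ₗ reverseChains V = reverseChains V ∘ₗ face ℤ .upper u :=
      linearMap_ext_path fun l => by
        rw [LinearMap.comp_apply, LinearMap.comp_apply, reverseChains_path]
        have ht : Side.lower.truncate l.reverse = (Side.upper.truncate l).reverse :=
          List.tail_reverse
        have he : Side.lower.endpoint (Side.lower.truncate l.reverse) =
            Side.upper.endpoint (Side.upper.truncate l) := by
          rw [ht]; exact List.head?_reverse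
        by_cases h : Side.upper.endpoint (Side.upper.truncate l) = some u
        · rw [face_path_of_eq h, face_path_of_eq (he.trans h), reverseChains_path, ht]
        · rw [face_path_of_ne h, face_path_of_ne (fun h' => h (he.symm.trans h')), map_zero]
    exact LinearMap.congr_fun this x
  extend_map v x := by
    have : extend G ℤ .lower v ∘ₗ reverseChains V =
        reverseChains V ∘ₗ extend (reverseDigraph G) ℤ .upper v :=
      linearMap_ext_path fun l => by
        rw [LinearMap.comp_apply, LinearMap.comp_apply, reverseChains_path]
        have h : (v :: l.reverse).IsChain G.Adj ↔ (l ++ [v]).IsChain (reverseDigraph G).Adj := by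
          rw [← List.isChain_reverse, List.reverse_cons, List.reverse_reverse]
          rfl
        by_cases h' : (l ++ [v]).IsChain (reverseDigraph G).Adj
        · rw [extend_path_of_isChain (s := .upper) h', extend_path_of_isChain (s := .lower) (h.2 h'),
            reverseChains_path]
          simp [Side.add]
        · rw [extend_path_of_not_isChain (s := .upper) h',
            extend_path_of_not_isChain (s := .lower) (fun h'' => h' (h.1 h'')), map_zero]
    exact LinearMap.congr_fun this x
  endSet_map x := by
    ext v
    constructor
    · rintro ⟨l, hl, h⟩
      refine ⟨l.reverse, ?_, ?_⟩
      · rw [Finsupp.mem_support_iff] at hl ⊢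
        rwa [← reverseChains_apply]
      · simpa [Side.endpoint] using h
    · rintro ⟨l, hl, h⟩
      refine ⟨l.reverse, ?_, ?_⟩
      · rw [Finsupp.mem_support_iff] at hl ⊢
        change reverseChains V x l.reverse ≠ 0
        rwa [reverseChains_apply, List.reverse_reverse]
      · simpa [Side.endpoint] using h
  joins_iff _ _ := Iff.rfl
  path_map v := by
    change reverseChains V (path ℤ [v]) = _
    rw [reverseChains_path]; rfl

theorem map_reverseChains_Omega (G : Digraph V) (n : ℤ) :
    (Omega (reverseDigraph G) ℤ n).map (reverseChains V) = Omega G ℤ n := by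
  apply le_antisymm
  · rintro _ ⟨x, hx, rfl⟩
    exact reverseChains_mem_Omega hx
  · intro x hx
    exact ⟨reverseChains V x, reverseChains_mem_Omega (G := reverseDigraph G) hx,
      reverseChains_reverseChains x⟩

theorem span_lower_of_upper {G : Digraph V} {i : ℕ}
    (h : Omega (reverseDigraph G) ℤ i ≤
      Submodule.span ℤ (inductiveElements (reverseDigraph G) ℤ .upper i)) :
    Omega G ℤ i ≤ Submodule.span ℤ (inductiveElements G ℤ .lower i) := by
  rw [← map_reverseChains_Omega]
  refine (Submodule.map_mono h).trans ?_
  rw [Submodule.map_span]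
  refine Submodule.span_mono ?_
  rintro _ ⟨x, hx, rfl⟩
  exact (isPathEmbedding_reverseChains G).mem_inductiveElements i hx

theorem exists_isBasisOf_lower_of_upper {G : Digraph V} {i : ℕ}
    (h : ∃ B ⊆ inductiveElements (reverseDigraph G) ℤ .upper i,
      IsBasisOf B (Omega (reverseDigraph G) ℤ i)) :
    ∃ B ⊆ inductiveElements G ℤ .lower i, IsBasisOf B (Omega G ℤ i) := by
  obtain ⟨B, hB, hind, hspan⟩ := h
  refine ⟨reverseChains V '' B, ?_, ?_, ?_⟩
  · rintro _ ⟨x, hx, rfl⟩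
    exact (isPathEmbedding_reverseChains G).mem_inductiveElements i (hB hx)
  · have hker : LinearMap.ker (reverseChains V) = ⊥ := LinearMap.ker_eq_bot.2
      (isPathEmbedding_reverseChains G).injective
    exact LinearIndepOn.id_image (v := reverseChains V) (hind.map' _ hker)
  · rw [← Submodule.map_span, hspan, map_reverseChains_Omega]

end Reversal

/-! ### Integral statements for both sides -/

section Integral

variable {V : Type*} (G : Digraph V)

theorem exists_isBasisOf_Omega_int (s : Side) (i : ℕ) (hi : i ≤ 2) :
    ∃ B ⊆ inductiveElements G ℤ s i, IsBasisOf B (Omega G ℤ i) := by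
  have upper : ∀ G : Digraph V,
      ∃ B ⊆ inductiveElements G ℤ .upper i, IsBasisOf B (Omega G ℤ i) := by
    intro G
    match i, hi with
    | 0, _ => exact exists_isBasisOf_Omega_zero
    | 1, _ => exact exists_isBasisOf_Omega_one
    | 2, _ => exact exists_isBasisOf_Omega_two
  cases s with
  | upper => exact upper G
  | lower => exact exists_isBasisOf_lower_of_upper (upper _)

theorem inductiveElements_subset_Omega_int (s : Side) (i : ℕ) :
    inductiveElements G ℤ s i ⊆ (Omega G ℤ i : Set (Chains V ℤ)) := by
  match i with
  | 0 =>
    rintro _ ⟨v, rfl | rfl⟩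
    · exact path_one_mem_Omega v
    · exact neg_mem (path_one_mem_Omega (G := G) v)
  | 1 => exact fun _ h => h.1
  | n + 2 =>
    intro x h
    have : ((n + 2 : ℕ) : ℤ) = (n : ℤ) + 2 := by push_cast; rfl
    rw [this]
    exact h.1

theorem span_inductiveElements_int (hG : ∀ v, ¬ G.Adj v v) (s : Side) (i : ℕ) (hi : i ≤ 3) :
    Submodule.span ℤ (inductiveElements G ℤ s i) = Omega G ℤ i := by
  refine le_antisymm (Submodule.span_le.2 (inductiveElements_subset_Omega_int G s i)) ?_
  rcases hi.lt_or_eq with hi | rfl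
  · obtain ⟨B, hB, -, hspan⟩ := exists_isBasisOf_Omega_int G s i (by omega)
    rw [← hspan]
    exact Submodule.span_mono hB
  · cases s with
    | upper => exact (span_inductiveElements_three_upper hG).ge
    | lower =>
      exact span_lower_of_upper (span_inductiveElements_three_upper (G := reverseDigraph G) hG).ge

end Integral

end PathHom

theorem mainTheorem2 {V : Type*} (G : Digraph V) (hG : ∀ v, ¬ G.Adj v v)
    (K : Type*) [Field K] [CharZero K] (s : PathHom.Side) :
    (∀ i : ℕ, i ≤ 2 →
      (∃ B ⊆ PathHom.inductiveElements G ℤ s i,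
        PathHom.IsBasisOf B (PathHom.Omega G ℤ i)) ∧
      (∃ B ⊆ PathHom.inductiveElements G K s i ∩
          PathHom.ofInt K '' PathHom.inductiveElements G ℤ s i,
        PathHom.IsBasisOf B (PathHom.Omega G K i))) ∧
    Submodule.span ℤ (PathHom.inductiveElements G ℤ s 3) = PathHom.Omega G ℤ 3 ∧
    (∃ B ⊆ PathHom.inductiveElements G K s 3 ∩
        PathHom.ofInt K '' PathHom.inductiveElements G ℤ s 3,
      PathHom.IsBasisOf B (PathHom.Omega G K 3)) := by
  refine ⟨fun i hi => ⟨PathHom.exists_isBasisOf_Omega_int G s i hi,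
    PathHom.exists_isBasisOf_of_span_eq K G s i
      (PathHom.span_inductiveElements_int G hG s i (by omega))⟩,
    PathHom.span_inductiveElements_int G hG s 3 le_rfl,
    PathHom.exists_isBasisOf_of_span_eq K G s 3
      (PathHom.span_inductiveElements_int G hG s 3 le_rfl)⟩
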